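/- Let $d\ge 1$, $\beta_0\in(0,1)$, and let $X=(X_t)_{t\ge0}$ be a symmetric Lévy process in $\mathbb R^d$ (started at $0$, with càdlàg paths) such that the law of $X_t$ has a density with respect to Lebesgue measure for every $t>0$. Let $\Psi:\mathbb R^d\to[0,\infty)$ be its characteristic exponent: $\mathbb E\,e^{i\xi\cdot X_t}=e^{-t\Psi(\xi)}$ for all $t\ge0$, $\xi\in\mathbb R^d$. Let $\gamma:\mathbb R^d\to[0,\infty]$ be a function with $\gamma(-x)=\gamma(x)$ such that 1. $\gamma$ is locally integrable and defines a tempered distribution; 2. its Fourier transform $\widehat\gamma$ (convention $\widehat\varphi(\xi)=\int e^{-i\xi\cdot x}\varphi(x)\,dx$) in the sense of tempered distributions is a measurable function that is nonnegative almost everywhere; 3. $\gamma$ is continuous as a map into $[0,\infty]$, the one-point compactification of $[0,\infty)$; 4. either $\gamma(x)<\infty\iff x\ne0$, or $\widehat\gamma\in L^\infty(\mathbb R^d)$ and $\gamma(x)<\infty$ for all $x\neq0$. Let $\mu(d\xi)=\widehat\gamma(\xi)\,d\xi$ be the spectral measure of $\gamma$, and for $t>0$ put $$H_t=\int_0^t\int_0^t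 |r-s|^{-\beta_0}\,\gamma(X_r-X_s)\,dr\,ds\in[0,\infty].$$ Consider **Hypothesis (I)**: $\displaystyle\int_{\mathbb R^d}\frac{1}{1+\Psi(\xi)^{1-\beta_0}}\,\mu(d\xi)<\infty.$ Then: (a) if Hypothesis (I) holds, then $\mathbb E\,e^{\lambda H_t}<\infty$ for all $t,\lambda>0$; (b) Hypothesis (I) holds if and only if $\mathbb E\,H_t<\infty$ for all $t>0$; (c) consequently integrability and exponential integrability are equivalent: for every $t>0$, $\mathbb E\,H_t<\infty$ if and only if $\mathbb E\,e^{\lambda H_t}<\infty$ for all $\lambda>0$. -/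

import Mathlib

open MeasureTheory ProbabilityTheory Filter Topology
open scoped NNReal ENNReal

namespace LevyHamiltonian

/-- Euclidean space `ℝᵈ`. -/
abbrev Space (d : ℕ) : Type := EuclideanSpace ℝ (Fin d)

/-- A symmetric Lévy process on `ℝᵈ`: it starts at `0`, has independent and stationary increments,
its paths are almost surely right-continuous with left limits (càdlàg), and `-X t` has the same law
as `X t`. (Stochastic continuity is a consequence of these properties.) -/
structure IsSymmetricLevyProcess {Ω : Type*} [MeasurableSpace Ω] {d : ℕ}
    (X : ℝ≥0 → Ω → Space d) (P : Measure Ω) : Prop where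
  measurable : ∀ t, Measurable (X t)
  start_zero : ∀ᵐ ω ∂P, X 0 ω = 0
  indep_increments : HasIndepIncrements X P
  stationary_increments : ∀ s h, P.map (fun ω => X (s + h) ω - X s ω) = P.map (X h)
  cadlag : ∀ᵐ ω ∂P, ∀ t : ℝ≥0, ContinuousWithinAt (fun s => X s ω) (Set.Ici t) t ∧
    ∃ l : Space d, Tendsto (fun s => X s ω) (𝓝[<] t) (𝓝 l)
  symm : ∀ t, P.map (fun ω => -X t ω) = P.map (X t)

/-- `X t` has a transition density `q_t` with respect to Lebesgue measure, for every `t > 0`. -/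
def HasTransitionDensities {Ω : Type*} [MeasurableSpace Ω] {d : ℕ}
    (X : ℝ≥0 → Ω → Space d) (P : Measure Ω) : Prop :=
  ∀ t, 0 < t → P.map (X t) ≪ (volume : Measure (Space d))

/-- `Ψ` is the (real) characteristic exponent of `X`:
`E exp (i ξ · X_t) = exp (-t Ψ(ξ))` for all `t ≥ 0` and `ξ`. -/
def IsCharExponent {Ω : Type*} [MeasurableSpace Ω] {d : ℕ}
    (X : ℝ≥0 → Ω → Space d) (P : Measure Ω) (Ψ : Space d → ℝ) : Prop :=
  ∀ (t : ℝ≥0) (ξ : Space d), charFun (P.map (X t)) ξ = Complex.exp (((-(t : ℝ) * Ψ ξ : ℝ)) : ℂ)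

/-- The Fourier transform with the convention `φ̂(x) = ∫ exp (-i x · ξ) φ(ξ) dξ`. -/
noncomputable def fourierHat {d : ℕ} (φ : Space d → ℂ) (x : Space d) : ℂ :=
  ∫ ξ, Complex.exp (-Complex.I * ((inner ℝ x ξ : ℝ) : ℂ)) * φ ξ

/-- The spectral measure `μ(dξ) = γ̂(ξ) dξ` with density the Fourier transform `γ̂` of `γ`. -/
noncomputable def spectralMeasure {d : ℕ} (γhat : Space d → ℝ) : Measure (Space d) :=
  volume.withDensity fun ξ => ENNReal.ofReal (γhat ξ)

/-- `γ : ℝᵈ → [0, ∞]` is an admissible covariance kernel with Fourier transform `γ̂`. The transform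
is taken in the sense of tempered distributions, `⟨γ̂, φ⟩ = ⟨γ, φ̂⟩` for Schwartz `φ`; for the
nonnegative functions `γ` and `γ̂` to be tempered distributions means that the measures `γ dx` and
`γ̂ dξ` have temperate growth. -/
structure IsAdmissibleKernel {d : ℕ} (γ : Space d → ℝ≥0∞) (γhat : Space d → ℝ) : Prop where
  even : ∀ x, γ (-x) = γ x
  locally_integrable : ∀ K : Set (Space d), IsCompact K → ∫⁻ x in K, γ x < ∞
  tempered : ((volume : Measure (Space d)).withDensity γ).HasTemperateGrowth
  measurable_hat : Measurable γhat
  hat_nonneg : ∀ᵐ ξ ∂(volume : Measure (Space d)), 0 ≤ γhat ξ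
  tempered_hat : (spectralMeasure γhat).HasTemperateGrowth
  fourier_eq : ∀ φ : SchwartzMap (Space d) ℂ,
    ∫ ξ, φ ξ ∂(spectralMeasure γhat)
      = ∫ x, fourierHat φ x ∂((volume : Measure (Space d)).withDensity γ)
  /-- Continuity into `[0, ∞]`, the one-point compactification of `[0, ∞)`. -/
  continuous : Continuous γ
  finiteness : (∀ x, γ x < ∞ ↔ x ≠ 0) ∨
    (MemLp γhat ∞ (volume : Measure (Space d)) ∧ ∀ x, x ≠ 0 → γ x < ∞)

/-- Hypothesis (I): `∫ (1 + Ψ(ξ)^(1 - β₀))⁻¹ μ(dξ) < ∞`. -/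
def HypothesisI {d : ℕ} (β₀ : ℝ) (Ψ : Space d → ℝ) (μ : Measure (Space d)) : Prop :=
  ∫⁻ ξ, ENNReal.ofReal (1 / (1 + Ψ ξ ^ (1 - β₀))) ∂μ < ∞

/-- The Hamiltonian `∫₀ᵗ ∫₀ᵗ |r - s|^(-β₀) γ(X_r - X_s) dr ds`, a `[0, ∞]`-valued random variable. -/
noncomputable def hamiltonian {Ω : Type*} {d : ℕ} (β₀ : ℝ) (γ : Space d → ℝ≥0∞)
    (X : ℝ≥0 → Ω → Space d) (t : ℝ) (ω : Ω) : ℝ≥0∞ :=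
  ∫⁻ s in Set.Icc (0 : ℝ) t, ∫⁻ r in Set.Icc (0 : ℝ) t,
    ENNReal.ofReal |r - s| ^ (-β₀) * γ (X r.toNNReal ω - X s.toNNReal ω)

/-- `E[H_t] ∈ [0, ∞]`. -/
noncomputable def meanHamiltonian {Ω : Type*} [MeasurableSpace Ω] {d : ℕ} (P : Measure Ω)
    (β₀ : ℝ) (γ : Space d → ℝ≥0∞) (X : ℝ≥0 → Ω → Space d) (t : ℝ) : ℝ≥0∞ :=
  ∫⁻ ω, hamiltonian β₀ γ X t ω ∂P

/-- `E[exp (lam * H_t)] ∈ [0, ∞]`, with `exp ∞ = ∞`. -/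
noncomputable def expMoment {Ω : Type*} [MeasurableSpace Ω] {d : ℕ} (P : Measure Ω)
    (β₀ : ℝ) (γ : Space d → ℝ≥0∞) (X : ℝ≥0 → Ω → Space d) (lam t : ℝ) : ℝ≥0∞ :=
  ∫⁻ ω, EReal.exp ((ENNReal.ofReal lam * hamiltonian β₀ γ X t ω : ℝ≥0∞) : EReal) ∂P

end LevyHamiltonian

open LevyHamiltonian

/-!
# Exponential integrability of a time-singular Hamiltonian of a Lévy process

Write `k(u) = (2π)^(-d) ∫ exp (-u Ψ) dμ` (`spectralMean`). The argument rests on two facts about the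
kernel: `E γ(x + X_u) ≤ k(u)` for every `x` (`lintegral_kernel_levy_le`), and `E γ(X_u) = k(u)` for
`u > 0` (`lintegral_kernel_levy`). The distributional identity defining `γ̂` gives Parseval's
identity for `γ` against a smooth bump convolved with any finite measure
(`lintegral_densityMeasure_conv`); letting the bump shrink and using Fatou gives the upper bound.
For the lower bound, `X_u` has the law of a difference of two independent copies of `X_{u/2}`, whose
law has a density. If the density were bounded, upper semicontinuous and compactly supported, the
energy of its translates would be upper semicontinuous, and the limit could be taken the other way
(`le_energy_of_upperSemicontinuous`); by Vitali–Carathéodory every density is approximated from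
below by such ones (`le_energy`).

Since `∫₀ᵗ u^(-β₀) exp (-u ψ) du` is comparable with `1 / (1 + ψ^(1 - β₀))`, Hypothesis (I) says
that `∫₀ᵗ u^(-β₀) k(u) du < ∞`, for one or equivalently for every `t > 0`
(`lintegral_timeWeight_spectralMean_lt_top_iff`). By stationarity
`E H_t ≥ (t/2) ∫₀^{t/2} u^(-β₀) k(u) du` (`le_meanHamiltonian`), so that finiteness of the mean at a
single time already implies Hypothesis (I).

For the exponential moments, `H_t ≤ 2 ∫₀ᵗ A_s ds` with `A_s = ∫₀ᵗ u^(-β₀) γ(X_{s+u} - X_s) du`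
(`forwardFunctional`), and Hölder's inequality reduces the moments of `H_t` to those of `A_s`. The
power `A_s^n` is bounded by `n!` times an integral over ordered times `u₁ ≤ ⋯ ≤ uₙ`. The Markov
property and the upper bound by `k` remove the times one after another, as in Khas'minskii's lemma.
The weight is not additive, but it is decreasing, so `u_{i+1}^(-β₀) ≤ (u_{i+1} - u_i)^(-β₀)`. With a
discount this yields `E A_s^n ≤ n! exp (θ t) κ^n`, where `κ = ∫₀ᵗ exp (-θ u) u^(-β₀) k(u) du`
(`lintegral_simplexIntegral_le`). As `κ → 0` for `θ → ∞`, the exponential series converges for every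
`lam` (`expMoment_lt_top`).
-/

namespace LevyHamiltonian

/-! ### The kernel against smooth densities -/

/-- The measure with density `S` with respect to Lebesgue measure. -/
noncomputable def densityMeasure {d : ℕ} (S : Space d → ℝ) : Measure (Space d) :=
  volume.withDensity fun x => ENNReal.ofReal (S x)

/-- The constant `(2π)^(-d)` of the inversion formula, in the form in which it arises from the
change of variables `x ↦ 2π x`. -/
noncomputable def inversionConst (d : ℕ) : ℝ :=
  |((2 * Real.pi) ^ Module.finrank ℝ (Space d))⁻¹|

lemma inversionConst_pos (d : ℕ) : 0 < inversionConst d := by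
  have := Real.pi_pos
  unfold inversionConst
  positivity

section Smooth

variable {d : ℕ} {S : Space d → ℝ}

lemma isFiniteMeasure_densityMeasure (hc : Continuous S) (hs : HasCompactSupport S) :
    IsFiniteMeasure (densityMeasure S) :=
  isFiniteMeasure_withDensity_ofReal (hc.integrable_of_hasCompactSupport hs).2

lemma charFun_densityMeasure (hc : Continuous S) (h0 : ∀ x, 0 ≤ S x) (ξ : Space d) :
    charFun (densityMeasure S) ξ
      = ∫ x, Complex.exp (((inner ℝ x ξ : ℝ) : ℂ) * Complex.I) * S x := by
  rw [charFun_apply, densityMeasure,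
    integral_withDensity_eq_integral_toReal_smul (by fun_prop) (by simp)]
  refine integral_congr_ae (ae_of_all _ fun x => ?_)
  simp only [ENNReal.toReal_ofReal (h0 x), Complex.real_smul]
  ring

/-- A smooth compactly supported density is, up to the inversion constant, the transform of a
Schwartz function, namely of its own characteristic function. -/
lemma exists_schwartz_fourierHat_eq (hS : ContDiff ℝ ((⊤ : ℕ∞) : WithTop ℕ∞) S)
    (hs : HasCompactSupport S) (h0 : ∀ x, 0 ≤ S x) :
    ∃ φ : SchwartzMap (Space d) ℂ, (∀ x, fourierHat φ x = S x) ∧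
      ∀ ξ, φ ξ = inversionConst d * charFun (densityMeasure S) ξ := by
  have hpi : (2 * Real.pi) ≠ 0 := by have := Real.pi_pos; positivity
  have hT : HasCompactSupport fun y : Space d => (S ((2 * Real.pi) • y) : ℂ) := by
    have := hs.comp_homeomorph (Homeomorph.smulOfNeZero (2 * Real.pi) hpi)
    exact this.comp_left (g := fun r : ℝ => (r : ℂ)) (by simp)
  have hT' : ContDiff ℝ ((⊤ : ℕ∞) : WithTop ℕ∞) fun y : Space d => (S ((2 * Real.pi) • y) : ℂ) :=
    Complex.ofRealCLM.contDiff.comp (hS.comp (contDiff_const_smul _))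
  -- Mathlib's transform carries `2π` in the exponent, hence the dilation by `2π`.
  set T := hT.toSchwartzMap hT'
  refine ⟨FourierTransformInv.fourierInv T, fun x => ?_, fun ξ => ?_⟩
  · have h1 : FourierTransform.fourier (FourierTransformInv.fourierInv T) ((2 * Real.pi)⁻¹ • x)
        = (S x : ℂ) := by
      rw [FourierTransform.fourier_fourierInv_eq]
      simp only [T, HasCompactSupport.toSchwartzMap_toFun, smul_smul, mul_inv_cancel₀ hpi, one_smul]
    rw [← h1, SchwartzMap.fourier_coe, Real.fourier_eq', fourierHat]
    refine integral_congr_ae (ae_of_all _ fun v => ?_)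
    simp only [smul_eq_mul]
    congr 2
    rw [real_inner_comm, inner_smul_right]
    have : (-2 * Real.pi * ((2 * Real.pi)⁻¹ * inner ℝ v x) : ℝ) = - inner ℝ v x := by
      field_simp
    rw [this]
    push_cast
    ring
  · rw [SchwartzMap.fourierInv_coe, Real.fourierInv_eq', charFun_densityMeasure hS.continuous h0]
    have := Measure.integral_comp_smul (volume : Measure (Space d))
      (fun x => Complex.exp (((inner ℝ x ξ : ℝ) : ℂ) * Complex.I) * S x) (2 * Real.pi)
    rw [inversionConst, ← Complex.real_smul, ← this]
    refine integral_congr_ae (ae_of_all _ fun v => ?_)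
    simp [T, inner_smul_left]

end Smooth

section Kernel

variable {d : ℕ} {γ : Space d → ℝ≥0∞} {γhat : Space d → ℝ} {S : Space d → ℝ}

lemma lintegral_densityMeasure_lt_top (hγ : IsAdmissibleKernel γ γhat) (hc : Continuous S)
    (hs : HasCompactSupport S) : ∫⁻ x, γ x ∂densityMeasure S < ∞ := by
  obtain ⟨C, hC⟩ := hs.exists_bound_of_continuous hc
  rw [densityMeasure, lintegral_withDensity_eq_lintegral_mul _ (by fun_prop)
    hγ.continuous.measurable]
  have hle : ∀ x, ((fun x => ENNReal.ofReal (S x)) * γ) x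
      ≤ (tsupport S).indicator (fun x => ENNReal.ofReal C * γ x) x := by
    intro x
    by_cases hx : x ∈ tsupport S
    · rw [Set.indicator_of_mem hx, Pi.mul_apply]
      gcongr
      exact (le_abs_self _).trans (hC x)
    · simp [image_eq_zero_of_notMem_tsupport hx]
  refine (lintegral_mono hle).trans_lt ?_
  rw [lintegral_indicator (isClosed_tsupport S).measurableSet,
    lintegral_const_mul _ hγ.continuous.measurable]
  exact ENNReal.mul_lt_top (by simp) (hγ.locally_integrable _ hs)

lemma integrable_charFun_densityMeasure (hγ : IsAdmissibleKernel γ γhat)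
    (hS : ContDiff ℝ ((⊤ : ℕ∞) : WithTop ℕ∞) S) (hs : HasCompactSupport S) (h0 : ∀ x, 0 ≤ S x) :
    Integrable (charFun (densityMeasure S)) (spectralMeasure γhat) := by
  obtain ⟨φ, -, hφ⟩ := exists_schwartz_fourierHat_eq hS hs h0
  have := hγ.tempered_hat
  have h1 : Integrable φ (spectralMeasure γhat) := φ.integrable
  have h2 := h1.const_mul ((inversionConst d : ℂ)⁻¹)
  refine h2.congr (ae_of_all _ fun ξ => ?_)
  have : (inversionConst d : ℂ) ≠ 0 := by exact_mod_cast (inversionConst_pos d).ne'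
  simp [hφ, this]

/-- The Fourier pairing of the kernel with a smooth compactly supported density. -/
lemma toReal_lintegral_densityMeasure (hγ : IsAdmissibleKernel γ γhat)
    (hS : ContDiff ℝ ((⊤ : ℕ∞) : WithTop ℕ∞) S) (hs : HasCompactSupport S) (h0 : ∀ x, 0 ≤ S x) :
    (((∫⁻ x, γ x ∂densityMeasure S).toReal : ℝ) : ℂ)
      = inversionConst d * ∫ ξ, charFun (densityMeasure S) ξ ∂spectralMeasure γhat := by
  obtain ⟨φ, hφ, hφ'⟩ := exists_schwartz_fourierHat_eq hS hs h0
  have h := hγ.fourier_eq φ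
  simp_rw [hφ, hφ'] at h
  rw [integral_const_mul] at h
  rw [h, integral_complex_ofReal, integral_eq_lintegral_of_nonneg_ae (ae_of_all _ h0)
    hS.continuous.aestronglyMeasurable, densityMeasure,
    lintegral_withDensity_eq_lintegral_mul _ (by have := hS.continuous; fun_prop)
    hγ.continuous.measurable, lintegral_withDensity_eq_lintegral_mul _
    hγ.continuous.measurable (by have := hS.continuous; fun_prop)]
  simp only [mul_comm]

lemma lintegral_densityMeasure_translate (hS : Continuous S) (f : Space d → ℝ≥0∞)
    (hf : Measurable f) (x : Space d) :
    ∫⁻ z, f (z + x) ∂densityMeasure S = ∫⁻ z, f z ∂densityMeasure fun z => S (z - x) := by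
  rw [densityMeasure, densityMeasure, lintegral_withDensity_eq_lintegral_mul _ (by fun_prop)
    (by fun_prop), lintegral_withDensity_eq_lintegral_mul _ (by fun_prop) hf,
    ← lintegral_add_right_eq_self
      ((fun z => ENNReal.ofReal (S (z - x))) * f : Space d → ℝ≥0∞) x]
  simp

lemma charFun_densityMeasure_translate (hS : Continuous S) (h0 : ∀ x, 0 ≤ S x)
    (x ξ : Space d) :
    charFun (densityMeasure fun z => S (z - x)) ξ
      = charFun (densityMeasure S) ξ * Complex.exp (((inner ℝ x ξ : ℝ) : ℂ) * Complex.I) := by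
  rw [charFun_densityMeasure (by fun_prop) (fun _ => h0 _), charFun_densityMeasure hS h0,
    ← integral_mul_const, ← integral_add_right_eq_self _ x]
  refine integral_congr_ae (ae_of_all _ fun z => ?_)
  simp only [inner_add_left, add_sub_cancel_right]
  push_cast
  rw [add_mul, Complex.exp_add]
  ring

/-- Parseval identity for the kernel and the convolution of a smooth compactly supported density
with an arbitrary finite measure. The identity for one density, applied to its translates, is
integrated against the measure; the spectral integral converges absolutely because the
characteristic function of the density decays rapidly. -/
lemma lintegral_densityMeasure_conv (hγ : IsAdmissibleKernel γ γhat)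
    (hS : ContDiff ℝ ((⊤ : ℕ∞) : WithTop ℕ∞) S) (hs : HasCompactSupport S) (h0 : ∀ x, 0 ≤ S x)
    (m : Measure (Space d)) [IsFiniteMeasure m] :
    ∫⁻ x, γ x ∂(densityMeasure S ∗ m) = ENNReal.ofReal (inversionConst d *
      (∫ ξ, charFun (densityMeasure S) ξ * charFun m ξ ∂spectralMeasure γhat).re) := by
  have hc := hS.continuous
  have := isFiniteMeasure_densityMeasure hc hs
  have : SigmaFinite (spectralMeasure γhat) := by unfold spectralMeasure; infer_instance
  have hγm := hγ.continuous.measurable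
  set χ := charFun (densityMeasure S) with hχ
  have hχi : Integrable χ (spectralMeasure γhat) := integrable_charFun_densityMeasure hγ hS hs h0
  have hpt : ∀ x, ∫⁻ z, γ (z + x) ∂densityMeasure S < ∞ ∧
      (((∫⁻ z, γ (z + x) ∂densityMeasure S).toReal : ℝ) : ℂ) = inversionConst d *
        ∫ ξ, χ ξ * Complex.exp (((inner ℝ x ξ : ℝ) : ℂ) * Complex.I) ∂spectralMeasure γhat := by
    intro x
    have hS' : ContDiff ℝ ((⊤ : ℕ∞) : WithTop ℕ∞) fun z => S (z - x) :=
      hS.comp (contDiff_id.sub contDiff_const)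
    have hs' : HasCompactSupport fun z => S (z - x) := by
      have := hs.comp_homeomorph (Homeomorph.addRight (-x))
      simpa [Function.comp_def, sub_eq_add_neg] using this
    rw [lintegral_densityMeasure_translate hc γ hγm]
    refine ⟨lintegral_densityMeasure_lt_top hγ hS'.continuous hs', ?_⟩
    rw [toReal_lintegral_densityMeasure hγ hS' hs' fun _ => h0 _]
    simp_rw [charFun_densityMeasure_translate hc h0]
    rfl
  have hint : Integrable (Function.uncurry fun (x ξ : Space d) =>
      χ ξ * Complex.exp (((inner ℝ x ξ : ℝ) : ℂ) * Complex.I)) (m.prod (spectralMeasure γhat)) := by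
    refine (hχi.comp_snd m).mono (by
      unfold Function.uncurry
      fun_prop) (ae_of_all _ fun p => ?_)
    simp [Function.uncurry, Complex.norm_exp_ofReal_mul_I]
  have hsw : ∫ x, ∫ ξ, χ ξ * Complex.exp (((inner ℝ x ξ : ℝ) : ℂ) * Complex.I)
      ∂spectralMeasure γhat ∂m = ∫ ξ, χ ξ * charFun m ξ ∂spectralMeasure γhat := by
    rw [integral_integral_swap hint]
    simp_rw [integral_const_mul, charFun_apply]
  rw [Measure.conv_comm, Measure.lintegral_conv hγm]
  have hF : ∀ x, (∫⁻ z, γ (z + x) ∂densityMeasure S).toReal = (inversionConst d *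
        ∫ ξ, χ ξ * Complex.exp (((inner ℝ x ξ : ℝ) : ℂ) * Complex.I) ∂spectralMeasure γhat).re :=
    fun x => by rw [← (hpt x).2, Complex.ofReal_re]
  have hF' : ∀ x, ∫⁻ z, γ (x + z) ∂densityMeasure S = ENNReal.ofReal ((inversionConst d *
        ∫ ξ, χ ξ * Complex.exp (((inner ℝ x ξ : ℝ) : ℂ) * Complex.I) ∂spectralMeasure γhat).re) :=
    fun x => by simp_rw [add_comm x]; rw [← hF, ENNReal.ofReal_toReal (hpt x).1.ne]
  set R : Space d → ℂ := fun x => inversionConst d *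
    ∫ ξ, χ ξ * Complex.exp (((inner ℝ x ξ : ℝ) : ℂ) * Complex.I) ∂spectralMeasure γhat with hR
  have hi : Integrable R m := hint.integral_prod_left.const_mul (inversionConst d : ℂ)
  have hRint : ∫ x, (R x).re ∂m
      = inversionConst d * (∫ ξ, χ ξ * charFun m ξ ∂spectralMeasure γhat).re := by
    have h1 : ∫ x, (R x).re ∂m = (∫ x, R x ∂m).re := integral_re hi
    rw [h1, hR, integral_const_mul, hsw, Complex.re_ofReal_mul]
  simp_rw [hF']
  rw [← hRint]
  exact (ofReal_integral_eq_lintegral_ofReal hi.re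
    (ae_of_all _ fun x => ENNReal.toReal_nonneg.trans_eq (hF x))).symm

end Kernel

/-! ### Mollification and energy bounds -/

section Mollifier

/-- A smooth bump at the origin supported in the ball of radius `1 / (n + 1)`. -/
noncomputable def originBump (d n : ℕ) : ContDiffBump (0 : Space d) where
  rIn := 1 / (2 * ((n : ℝ) + 1))
  rOut := 1 / ((n : ℝ) + 1)
  rIn_pos := by positivity
  rIn_lt_rOut := by
    apply one_div_lt_one_div_of_lt <;> [positivity; linarith [(Nat.cast_nonneg n : (0:ℝ) ≤ n)]]

/-- The smooth probability densities `originBump` normalised; they approximate the Dirac mass at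
the origin. -/
noncomputable def mollifier (d n : ℕ) : Space d → ℝ := (originBump d n).normed volume

lemma contDiff_mollifier (d n : ℕ) : ContDiff ℝ ((⊤ : ℕ∞) : WithTop ℕ∞) (mollifier d n) :=
  (originBump d n).contDiff_normed

lemma hasCompactSupport_mollifier (d n : ℕ) : HasCompactSupport (mollifier d n) :=
  (originBump d n).hasCompactSupport_normed

lemma mollifier_nonneg (d n : ℕ) (x : Space d) : 0 ≤ mollifier d n x :=
  (originBump d n).nonneg_normed x

instance isProbabilityMeasure_mollifier (d n : ℕ) :
    IsProbabilityMeasure (densityMeasure (mollifier d n)) := by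
  constructor
  rw [densityMeasure, withDensity_apply _ MeasurableSet.univ, Measure.restrict_univ,
    ← ofReal_integral_eq_lintegral_ofReal
      ((contDiff_mollifier d n).continuous.integrable_of_hasCompactSupport
        (hasCompactSupport_mollifier d n)) (ae_of_all _ (mollifier_nonneg d n)), mollifier,
    ContDiffBump.integral_normed, ENNReal.ofReal_one]

lemma ae_norm_lt_mollifier (d n : ℕ) :
    ∀ᵐ z ∂densityMeasure (mollifier d n), ‖z‖ < 1 / ((n : ℝ) + 1) := by
  have hm := (contDiff_mollifier d n).continuous
  rw [densityMeasure, ae_withDensity_iff (by fun_prop)]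
  refine ae_of_all _ fun z hz => ?_
  have : z ∈ Function.support ((originBump d n).normed volume) := by
    intro h0
    apply hz
    simp [mollifier, h0]
  rw [ContDiffBump.support_normed_eq] at this
  simpa [originBump] using this

lemma tendsto_charFun_mollifier (d : ℕ) (ξ : Space d) :
    Tendsto (fun n => charFun (densityMeasure (mollifier d n)) ξ) atTop (𝓝 1) := by
  rw [tendsto_iff_norm_sub_tendsto_zero]
  have hlim : Tendsto (fun n : ℕ => (1 / ((n : ℝ) + 1)) * ‖ξ‖) atTop (𝓝 0) := by
    simpa using (tendsto_one_div_add_atTop_nhds_zero_nat (𝕜 := ℝ)).mul_const ‖ξ‖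
  refine squeeze_zero (fun _ => norm_nonneg _) (fun n => ?_) hlim
  have hint : Integrable (fun x : Space d => Complex.exp (((inner ℝ x ξ : ℝ) : ℂ) * Complex.I))
      (densityMeasure (mollifier d n)) :=
    (integrable_const (1 : ℝ)).mono (by fun_prop) (by simp [Complex.norm_exp_ofReal_mul_I])
  have h1 : charFun (densityMeasure (mollifier d n)) ξ - 1
      = ∫ x, (Complex.exp (((inner ℝ x ξ : ℝ) : ℂ) * Complex.I) - 1)
        ∂densityMeasure (mollifier d n) := by
    rw [integral_sub hint (integrable_const _), charFun_apply]
    simp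
  rw [h1]
  refine (norm_integral_le_of_norm_le_const (C := 1 / ((n : ℝ) + 1) * ‖ξ‖) ?_).trans (by simp)
  filter_upwards [ae_norm_lt_mollifier d n] with z hz
  rw [mul_comm]
  refine (Real.norm_exp_I_mul_ofReal_sub_one_le).trans ?_
  exact (norm_inner_le_norm _ _).trans (by gcongr)

/-- Lower semicontinuity suffices for this half of the convergence of mollifications; the values
may be infinite. -/
lemma le_liminf_lintegral_mollifier {d : ℕ} {f : Space d → ℝ≥0∞} (hf : Continuous f)
    (x : Space d) :
    f x ≤ liminf (fun n => ∫⁻ z, f (x + z) ∂densityMeasure (mollifier d n)) atTop := by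
  refine le_of_forall_lt fun a ha => ?_
  obtain ⟨b, hab, hb⟩ := exists_between ha
  refine hab.trans_le (le_liminf_of_le (by isBoundedDefault) ?_)
  have hcont : Continuous fun z => f (x + z) := by fun_prop
  have hev : ∀ᶠ z in 𝓝 (0 : Space d), b < f (x + z) := by
    apply hcont.continuousAt.eventually_const_lt
    simpa using hb
  obtain ⟨r, hr, hball⟩ := Metric.eventually_nhds_iff.1 hev
  filter_upwards [(tendsto_one_div_add_atTop_nhds_zero_nat (𝕜 := ℝ)).eventually_lt_const hr]
    with n hn
  calc b = ∫⁻ _, b ∂densityMeasure (mollifier d n) := by simp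
    _ ≤ _ := lintegral_mono_ae <| by
      filter_upwards [ae_norm_lt_mollifier d n] with z hz
      exact (hball (by simpa using hz.trans hn)).le

lemma limsup_lintegral_mollifier_le {d : ℕ} {J : Space d → ℝ≥0∞}
    (hJ : UpperSemicontinuousAt J 0) :
    limsup (fun n => ∫⁻ z, ∫⁻ w, J (z - w) ∂densityMeasure (mollifier d n)
      ∂densityMeasure (mollifier d n)) atTop ≤ J 0 := by
  refine le_of_forall_gt fun a ha => ?_
  obtain ⟨b, hb, hab⟩ := exists_between ha
  refine (limsup_le_of_le (by isBoundedDefault) ?_).trans_lt hab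
  obtain ⟨r, hr, hball⟩ := Metric.eventually_nhds_iff.1 (hJ b hb)
  filter_upwards [(tendsto_one_div_add_atTop_nhds_zero_nat (𝕜 := ℝ)).eventually_lt_const
    (half_pos hr)] with n hn
  calc _ ≤ ∫⁻ _ : Space d, ∫⁻ _ : Space d, b ∂densityMeasure (mollifier d n)
        ∂densityMeasure (mollifier d n) := by
        refine lintegral_mono_ae ?_
        filter_upwards [ae_norm_lt_mollifier d n] with z hz
        refine lintegral_mono_ae ?_
        filter_upwards [ae_norm_lt_mollifier d n] with w hw
        refine (hball ?_).le
        rw [dist_zero_right]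
        linarith [norm_sub_le z w]
    _ = b := by simp

end Mollifier

section Energy

variable {d : ℕ} {γ : Space d → ℝ≥0∞} {γhat : Space d → ℝ}

/-- The integral of the kernel against a finite measure is at most the spectral integral of the
modulus of the characteristic function of that measure: Parseval for the mollified measure, then
Fatou. -/
lemma lintegral_kernel_le (hγ : IsAdmissibleKernel γ γhat) (m : Measure (Space d))
    [IsFiniteMeasure m] :
    ∫⁻ x, γ x ∂m ≤ ENNReal.ofReal (inversionConst d) *
      ∫⁻ ξ, ‖charFun m ξ‖ₑ ∂spectralMeasure γhat := by
  have hγm := hγ.continuous.measurable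
  calc ∫⁻ x, γ x ∂m
      ≤ ∫⁻ x, liminf (fun n => ∫⁻ z, γ (x + z) ∂densityMeasure (mollifier d n)) atTop ∂m :=
        lintegral_mono fun x => le_liminf_lintegral_mollifier hγ.continuous x
    _ ≤ liminf (fun n => ∫⁻ x, ∫⁻ z, γ (x + z) ∂densityMeasure (mollifier d n) ∂m) atTop :=
        lintegral_liminf_le fun n => Measurable.lintegral_prod_right' (f := fun p => γ (p.1 + p.2))
          (by fun_prop)
    _ ≤ _ := by
        refine liminf_le_of_frequently_le' (Frequently.of_forall fun n => ?_)
        rw [← Measure.lintegral_conv hγm, Measure.conv_comm,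
          lintegral_densityMeasure_conv hγ (contDiff_mollifier d n)
          (hasCompactSupport_mollifier d n) (mollifier_nonneg d n) m,
          ENNReal.ofReal_mul (inversionConst_pos d).le]
        gcongr
        refine (ENNReal.ofReal_le_ofReal (Complex.re_le_norm _)).trans ?_
        rw [ofReal_norm]
        refine (enorm_integral_le_lintegral_enorm _).trans (lintegral_mono fun ξ => ?_)
        rw [enorm_mul]
        refine mul_le_of_le_one_left' ?_
        rw [← ofReal_norm]
        exact ENNReal.ofReal_le_one.2 (norm_charFun_le_one (μ := densityMeasure (mollifier d n)) ξ)

lemma charFun_map_neg (m : Measure (Space d)) (ξ : Space d) :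
    charFun (m.map (fun x => -x)) ξ = (starRingEnd ℂ) (charFun m ξ) := by
  have := charFun_map_smul (μ := m) (-1) ξ
  simpa using this

/-- The interaction energy of a measure with its translate by `z` is upper semicontinuous in `z` at
the origin if the density is bounded, upper semicontinuous and compactly supported: moving the
translation from the kernel to the density leaves an integrand dominated by a locally integrable
function, and reverse Fatou applies. -/
lemma upperSemicontinuousAt_energy (hγ : IsAdmissibleKernel γ γhat) {g : Space d → ℝ≥0}
    (hg : UpperSemicontinuous g) {N : ℝ≥0} {R : ℝ} (hN : ∀ x, g x ≤ N)
    (hR : ∀ x, R < ‖x‖ → g x = 0) :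
    UpperSemicontinuousAt (fun z => ∫⁻ y, ∫⁻ x, γ (z + (x - y))
      ∂(volume.withDensity fun x => (g x : ℝ≥0∞))
      ∂(volume.withDensity fun x => (g x : ℝ≥0∞))) 0 := by
  have hγm := hγ.continuous.measurable
  have hgm : Measurable g := hg.measurable
  set Γ := (volume : Measure (Space d)).withDensity γ with hΓ
  have hJ : ∀ z, ∫⁻ y, ∫⁻ x, γ (z + (x - y))
      ∂(volume.withDensity fun x => (g x : ℝ≥0∞)) ∂(volume.withDensity fun x => (g x : ℝ≥0∞))
      = ∫⁻ p : Space d × Space d, (g p.1 : ℝ≥0∞) * g (p.2 + p.1 - z) ∂(volume.prod Γ) := by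
    intro z
    rw [lintegral_withDensity_eq_lintegral_mul _ (by fun_prop)
      (Measurable.lintegral_prod_right' (f := fun p : Space d × Space d => γ (z + (p.2 - p.1)))
        (by fun_prop)), lintegral_prod _ (by fun_prop)]
    refine lintegral_congr fun y => ?_
    dsimp only [Pi.mul_apply]
    rw [lintegral_const_mul _ (by fun_prop), hΓ,
      lintegral_withDensity_eq_lintegral_mul _ (by fun_prop) (by fun_prop),
      lintegral_withDensity_eq_lintegral_mul _ hγm (by fun_prop)]
    congr 1
    rw [← lintegral_add_right_eq_self (_ * fun x => γ (z + (x - y))) (y - z)]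
    refine lintegral_congr fun w => ?_
    simp only [Pi.mul_apply]
    rw [mul_comm]
    congr 2
    · abel
    · congr 1
      abel_nf
  -- For `‖z‖ < 1` the integrand vanishes unless `‖y‖ ≤ R` and `‖w‖ ≤ 2 R + 1`.
  set B : Space d × Space d → ℝ≥0∞ := fun p => (Metric.closedBall (0 : Space d) R).indicator
    (fun _ => (N : ℝ≥0∞)) p.1 * (Metric.closedBall (0 : Space d) (2 * R + 1)).indicator
    (fun _ => (N : ℝ≥0∞)) p.2 with hB
  have hBfin : ∫⁻ p, B p ∂(volume.prod Γ) ≠ ∞ := by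
    have h1 : Measurable ((Metric.closedBall (0 : Space d) R).indicator
      (fun _ => (N : ℝ≥0∞))) := measurable_const.indicator Metric.isClosed_closedBall.measurableSet
    have h2 : Measurable ((Metric.closedBall (0 : Space d) (2 * R + 1)).indicator
      (fun _ => (N : ℝ≥0∞))) := measurable_const.indicator Metric.isClosed_closedBall.measurableSet
    rw [hB, lintegral_prod_mul h1.aemeasurable h2.aemeasurable,
      lintegral_indicator Metric.isClosed_closedBall.measurableSet,
      lintegral_indicator Metric.isClosed_closedBall.measurableSet, lintegral_const,
      lintegral_const,
      Measure.restrict_apply_univ, Measure.restrict_apply_univ, hΓ,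
      withDensity_apply _ Metric.isClosed_closedBall.measurableSet]
    refine ENNReal.mul_ne_top (ENNReal.mul_ne_top (by simp) measure_closedBall_lt_top.ne)
      (ENNReal.mul_ne_top (by simp) (hγ.locally_integrable _ (isCompact_closedBall _ _)).ne)
  intro a ha
  by_contra hcon
  have hfr := (not_eventually.1 hcon).and_eventually (Metric.ball_mem_nhds (0 : Space d) one_pos)
  obtain ⟨zs, hzs, hbad⟩ := exists_seq_forall_of_frequently hfr
  simp_rw [hJ] at hbad ha
  have hls := limsup_lintegral_le (μ := volume.prod Γ)
    (f := fun k p => (g p.1 : ℝ≥0∞) * g (p.2 + p.1 - zs k)) B (fun k => by fun_prop)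
    (fun k => ae_of_all _ fun p => by
      by_cases h1 : p.1 ∈ Metric.closedBall (0 : Space d) R
      · by_cases h2 : p.2 ∈ Metric.closedBall (0 : Space d) (2 * R + 1)
        · simp only [hB, Set.indicator_of_mem h1, Set.indicator_of_mem h2]
          gcongr
          · exact hN _
          · exact hN _
        · have : g (p.2 + p.1 - zs k) = 0 := by
            apply hR
            have h3 := (hbad k).2
            simp only [Metric.mem_closedBall, dist_zero_right, not_le] at h1 h2 h3
            have h4 := norm_sub_norm_le p.2 (zs k - p.1)
            have h5 := norm_sub_le (zs k) p.1
            have h6 : p.2 - (zs k - p.1) = p.2 + p.1 - zs k := by abel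
            rw [h6] at h4
            linarith
          simp [this]
      · have : g p.1 = 0 := by
          apply hR
          simpa using h1
        simp [this]) hBfin
  have h1 : a ≤ limsup (fun k => ∫⁻ p : Space d × Space d, (g p.1 : ℝ≥0∞) * g (p.2 + p.1 - zs k)
      ∂(volume.prod Γ)) atTop :=
    le_limsup_of_frequently_le (Frequently.of_forall fun k => not_lt.1 (hbad k).1)
      (by isBoundedDefault)
  refine absurd (h1.trans (hls.trans (lintegral_mono fun p => ?_))) (not_le.2 ha)
  simp only [sub_zero]
  rw [ENNReal.limsup_const_mul_of_ne_top (by simp)]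
  gcongr
  refine le_of_forall_gt fun b hb => ?_
  obtain ⟨c, hc, hcb⟩ := exists_between hb
  refine (limsup_le_of_le (by isBoundedDefault) ?_).trans_lt hcb
  have htend : Tendsto (fun k => p.2 + p.1 - zs k) atTop (𝓝 (p.2 + p.1)) := by
    simpa using tendsto_const_nhds.sub hzs
  induction c with
  | top => simp at hcb
  | coe c =>
    filter_upwards [htend.eventually (hg _ c (by exact_mod_cast hc))] with k hk
    exact_mod_cast hk.le

/-- The spectral energy is at most the interaction energy, for a measure with a bounded, upper
semicontinuous, compactly supported density. Mollifying both copies of the measure gives equality;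
Fatou on the spectral side and upper semicontinuity of the energy of translates give the limit. -/
lemma le_energy_of_upperSemicontinuous (hγ : IsAdmissibleKernel γ γhat) {g : Space d → ℝ≥0}
    (hg : UpperSemicontinuous g) {N : ℝ≥0} {R : ℝ} (hN : ∀ x, g x ≤ N)
    (hR : ∀ x, R < ‖x‖ → g x = 0) (ν : Measure (Space d)) [IsFiniteMeasure ν]
    (hν : ν = volume.withDensity fun x => (g x : ℝ≥0∞)) :
    ENNReal.ofReal (inversionConst d) * ∫⁻ ξ, ‖charFun ν ξ‖ₑ ^ 2 ∂spectralMeasure γhat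
      ≤ ∫⁻ y, ∫⁻ x, γ (x - y) ∂ν ∂ν := by
  have hγm := hγ.continuous.measurable
  have husc := upperSemicontinuousAt_energy hγ hg hN hR
  rw [← hν] at husc
  set J : Space d → ℝ≥0∞ := fun z => ∫⁻ y, ∫⁻ x, γ (z + (x - y)) ∂ν ∂ν with hJ
  have hJ0 : J 0 = ∫⁻ y, ∫⁻ x, γ (x - y) ∂ν ∂ν := by simp [hJ]
  have hneg : Measurable fun x : Space d => -x := measurable_neg
  have hkey : ∀ n, ENNReal.ofReal (inversionConst d) *
      ∫⁻ ξ, ‖charFun (densityMeasure (mollifier d n)) ξ‖ₑ ^ 2 * ‖charFun ν ξ‖ₑ ^ 2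
        ∂spectralMeasure γhat
      = ∫⁻ z, ∫⁻ w, J (z - w) ∂densityMeasure (mollifier d n)
        ∂densityMeasure (mollifier d n) := by
    intro n
    set θ := densityMeasure (mollifier d n) with hθ
    have hχi : Integrable (charFun θ) (spectralMeasure γhat) :=
      integrable_charFun_densityMeasure hγ (contDiff_mollifier d n)
        (hasCompactSupport_mollifier d n) (mollifier_nonneg d n)
    have h := lintegral_densityMeasure_conv hγ (contDiff_mollifier d n)
      (hasCompactSupport_mollifier d n) (mollifier_nonneg d n)
      ((θ.map fun x => -x) ∗ ((ν.map fun x => -x) ∗ ν))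
    rw [← hθ] at h
    have hchar : ∀ ξ, charFun θ ξ * charFun ((θ.map fun x => -x) ∗ ((ν.map fun x => -x) ∗ ν)) ξ
        = ((‖charFun θ ξ‖ ^ 2 * ‖charFun ν ξ‖ ^ 2 : ℝ) : ℂ) := by
      intro ξ
      rw [charFun_conv, charFun_conv, charFun_map_neg, charFun_map_neg]
      push_cast
      rw [← Complex.mul_conj', ← Complex.mul_conj']
      ring
    simp_rw [hchar] at h
    rw [integral_complex_ofReal, Complex.ofReal_re, ENNReal.ofReal_mul (inversionConst_pos d).le,
      ofReal_integral_eq_lintegral_ofReal ?_ (ae_of_all _ fun ξ => by positivity)] at h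
    · have hconv : ∫⁻ x, γ x ∂(θ ∗ ((θ.map fun x => -x) ∗ ((ν.map fun x => -x) ∗ ν)))
          = ∫⁻ z, ∫⁻ w, J (z - w) ∂θ ∂θ := by
        rw [Measure.lintegral_conv hγm]
        refine lintegral_congr fun z => ?_
        rw [Measure.lintegral_conv (by fun_prop), lintegral_map _ hneg]
        · refine lintegral_congr fun w => ?_
          rw [Measure.lintegral_conv (by fun_prop), lintegral_map _ hneg]
          · refine lintegral_congr fun y => lintegral_congr fun x => ?_
            congr 1
            abel
          · exact Measurable.lintegral_prod_right'
              (f := fun p : Space d × Space d => γ (z + (-w + (p.1 + p.2)))) (by fun_prop)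
        · exact Measurable.lintegral_prod_right'
            (f := fun p : Space d × Space d => γ (z + (p.1 + p.2))) (by fun_prop)
      rw [← hconv, h]
      congr 1
      refine lintegral_congr fun ξ => ?_
      rw [ENNReal.ofReal_mul (by positivity), ENNReal.ofReal_pow (norm_nonneg _),
        ENNReal.ofReal_pow (norm_nonneg _), ofReal_norm, ofReal_norm]
    · refine (hχi.norm.mul_const ((ν.real Set.univ) ^ 2)).mono (by fun_prop)
        (ae_of_all _ fun ξ => ?_)
      rw [Real.norm_of_nonneg (by positivity), Real.norm_of_nonneg (by positivity)]
      gcongr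
      · have h1 : ‖charFun θ ξ‖ ≤ 1 := norm_charFun_le_one ξ
        nlinarith [norm_nonneg (charFun θ ξ)]
      · exact norm_charFun_le ξ
  calc ENNReal.ofReal (inversionConst d) * ∫⁻ ξ, ‖charFun ν ξ‖ₑ ^ 2 ∂spectralMeasure γhat
      = ENNReal.ofReal (inversionConst d) * ∫⁻ ξ, liminf (fun n =>
          ‖charFun (densityMeasure (mollifier d n)) ξ‖ₑ ^ 2 * ‖charFun ν ξ‖ₑ ^ 2) atTop
          ∂spectralMeasure γhat := by
        congr 1
        refine lintegral_congr fun ξ => ?_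
        have h1 := ENNReal.Tendsto.pow (n := 2) (tendsto_charFun_mollifier d ξ).enorm
        have h2 := ENNReal.Tendsto.mul_const (b := ‖charFun ν ξ‖ₑ ^ 2) h1 (Or.inl (by simp))
        rw [h2.liminf_eq]
        simp
    _ ≤ ENNReal.ofReal (inversionConst d) * liminf (fun n => ∫⁻ ξ,
          ‖charFun (densityMeasure (mollifier d n)) ξ‖ₑ ^ 2 * ‖charFun ν ξ‖ₑ ^ 2
          ∂spectralMeasure γhat) atTop := by
        gcongr
        exact lintegral_liminf_le fun n => by fun_prop
    _ = liminf (fun n => ∫⁻ z, ∫⁻ w, J (z - w) ∂densityMeasure (mollifier d n)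
        ∂densityMeasure (mollifier d n)) atTop := by
        rw [← ENNReal.liminf_const_mul_of_ne_top (by simp)]
        simp_rw [hkey]
    _ ≤ J 0 := (liminf_le_limsup).trans (limsup_lintegral_mollifier_le husc)
    _ = _ := hJ0

end Energy

/-! ### The mean of the kernel along the process -/

section Energy

variable {d : ℕ} {γ : Space d → ℝ≥0∞} {γhat : Space d → ℝ}

/-- An integrable density is approximated from below in mass by bounded, compactly supported, upper
semicontinuous densities: truncation followed by Vitali–Carathéodory. -/
lemma exists_upperSemicontinuous_density (f : Space d → ℝ≥0) (hf : Measurable f)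
    (hfi : ∫⁻ x, f x ≠ ∞) {ε : ℝ≥0∞} (hε : ε ≠ 0) :
    ∃ (g : Space d → ℝ≥0) (N : ℕ), UpperSemicontinuous g ∧ (∀ x, g x ≤ f x) ∧
      (∀ x, g x ≤ (N : ℝ≥0)) ∧ (∀ x, (N : ℝ) < ‖x‖ → g x = 0) ∧
      ∫⁻ x, (f x : ℝ≥0∞) ≤ (∫⁻ x, (g x : ℝ≥0∞)) + ε := by
  set F : ℕ → Space d → ℝ≥0 := fun N =>
    (Metric.closedBall (0 : Space d) N).indicator fun x => min (f x) N with hF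
  have hFle : ∀ N x, F N x ≤ f x := fun N x => by
    by_cases hx : x ∈ Metric.closedBall (0 : Space d) N
    · simp [hF, hx]
    · simp [hF, hx]
  have hFm : ∀ N, Measurable (F N) := fun N =>
    (hf.min measurable_const).indicator Metric.isClosed_closedBall.measurableSet
  have hlim : Tendsto (fun N => ∫⁻ x, (F N x : ℝ≥0∞)) atTop (𝓝 (∫⁻ x, (f x : ℝ≥0∞))) := by
    refine tendsto_lintegral_of_dominated_convergence (fun x => (f x : ℝ≥0∞))
      (fun N => (hFm N).coe_nnreal_ennreal)
      (fun N => ae_of_all _ fun x => ENNReal.coe_le_coe.2 (hFle N x)) hfi (ae_of_all _ fun x => ?_)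
    refine tendsto_const_nhds.congr' ?_
    filter_upwards [eventually_ge_atTop ⌈‖x‖⌉₊, eventually_ge_atTop ⌈f x⌉₊] with N h1 h2
    have hx : x ∈ Metric.closedBall (0 : Space d) N := by
      simpa using (Nat.le_ceil ‖x‖).trans (by exact_mod_cast h1)
    have h3 : f x ≤ N := (Nat.le_ceil (f x)).trans (by exact_mod_cast h2)
    simp only [hF, Set.indicator_of_mem hx, min_eq_left h3]
  have hε2 : ε / 2 ≠ 0 := (ENNReal.half_pos hε).ne'
  have hlt : ∀ᶠ N in atTop, ∫⁻ x, (f x : ℝ≥0∞) ≤ (∫⁻ x, (F N x : ℝ≥0∞)) + ε / 2 := by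
    have := hlim.add_const (ε / 2)
    filter_upwards [this.eventually_const_lt (ENNReal.lt_add_right hfi hε2)] with N hN using hN.le
  obtain ⟨N, hN⟩ := hlt.exists
  obtain ⟨g, hgF, hg, hgi⟩ := exists_upperSemicontinuous_le_lintegral_le (μ := volume) (F N)
    (ne_top_of_le_ne_top hfi (lintegral_mono fun x => ENNReal.coe_le_coe.2 (hFle N x))) hε2
  refine ⟨g, N, hg, fun x => (hgF x).trans (hFle N x), fun x => (hgF x).trans ?_,
    fun x hx => ?_, ?_⟩
  · by_cases hx : x ∈ Metric.closedBall (0 : Space d) N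
    · simp [hF, hx]
    · simp [hF, hx]
  · have hx' : x ∉ Metric.closedBall (0 : Space d) N := by simpa using hx
    have := hgF x
    simpa [hF, hx'] using this
  · calc _ ≤ _ := hN
      _ ≤ (∫⁻ x, (g x : ℝ≥0∞)) + ε / 2 + ε / 2 := by gcongr
      _ = _ := by rw [add_assoc, ENNReal.add_halves]

/-- The spectral energy of an absolutely continuous probability measure is at most its
interaction energy. The left-hand side passes to the limit along densities below that of `p` by
Fatou, the right-hand side is monotone in the measure. -/
lemma le_energy (hγ : IsAdmissibleKernel γ γhat) (p : Measure (Space d))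
    [IsProbabilityMeasure p] (hp : p ≪ volume) :
    ENNReal.ofReal (inversionConst d) * ∫⁻ ξ, ‖charFun p ξ‖ₑ ^ 2 ∂spectralMeasure γhat
      ≤ ∫⁻ y, ∫⁻ x, γ (x - y) ∂p ∂p := by
  have hγm := hγ.continuous.measurable
  set f : Space d → ℝ≥0 := fun x => (p.rnDeriv volume x).toNNReal with hf
  have hfm : Measurable f := (Measure.measurable_rnDeriv _ _).ennreal_toNNReal
  have hpf : p = volume.withDensity fun x => (f x : ℝ≥0∞) := by
    conv_lhs => rw [← Measure.withDensity_rnDeriv_eq p volume hp]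
    refine withDensity_congr_ae ?_
    filter_upwards [Measure.rnDeriv_lt_top p volume] with x hx
    simp [hf, ENNReal.coe_toNNReal hx.ne]
  have hf1 : ∫⁻ x, (f x : ℝ≥0∞) = 1 := by
    have : p Set.univ = 1 := measure_univ
    rwa [hpf, withDensity_apply _ MeasurableSet.univ, Measure.restrict_univ] at this
  have hex : ∀ n : ℕ, ∃ ν : Measure (Space d), IsFiniteMeasure ν ∧
      (∀ ξ, ‖charFun ν ξ - charFun p ξ‖ ≤ 1 / ((n : ℝ) + 1)) ∧
      ENNReal.ofReal (inversionConst d) * ∫⁻ ξ, ‖charFun ν ξ‖ₑ ^ 2 ∂spectralMeasure γhat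
      ≤ ∫⁻ y, ∫⁻ x, γ (x - y) ∂p ∂p := by
    intro n
    have hpos : (0 : ℝ) < 1 / ((n : ℝ) + 1) := by positivity
    obtain ⟨g, N, hg, hgf, hN, hR, hgi⟩ := exists_upperSemicontinuous_density f hfm
      (by simp [hf1]) (ε := ENNReal.ofReal (1 / ((n : ℝ) + 1))) (by simpa using hpos)
    have hgm : Measurable g := hg.measurable
    have hgfin : ∫⁻ x, (g x : ℝ≥0∞) ≠ ∞ :=
      ne_top_of_le_ne_top (by simp [hf1])
        (lintegral_mono fun x => (by exact_mod_cast hgf x : (g x : ℝ≥0∞) ≤ f x))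
    set ν := (volume : Measure (Space d)).withDensity fun x => (g x : ℝ≥0∞) with hν
    set ρ := (volume : Measure (Space d)).withDensity fun x => ((f x - g x : ℝ≥0) : ℝ≥0∞) with hρ
    have hsum : p = ν + ρ := by
      rw [hν, hρ, ← withDensity_add_left (by fun_prop), hpf]
      congr 1
      ext x
      rw [Pi.add_apply, ← ENNReal.coe_add, add_tsub_cancel_of_le (hgf x)]
    have hνf : IsFiniteMeasure ν := isFiniteMeasure_withDensity hgfin
    have hρf : IsFiniteMeasure ρ := by
      refine isFiniteMeasure_withDensity (ne_top_of_le_ne_top (by simp [hf1])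
        (lintegral_mono fun x => (by exact_mod_cast tsub_le_self :
          ((f x - g x : ℝ≥0) : ℝ≥0∞) ≤ f x)))
    have hρle : ρ Set.univ ≤ ENNReal.ofReal (1 / ((n : ℝ) + 1)) := by
      have h1 : p Set.univ = ν Set.univ + ρ Set.univ := by
        conv_lhs => rw [hsum]
        rfl
      have h2 : ν Set.univ = ∫⁻ x, (g x : ℝ≥0∞) := by
        rw [hν, withDensity_apply _ MeasurableSet.univ, Measure.restrict_univ]
      rw [measure_univ] at h1
      rw [hf1, h1, h2] at hgi
      exact (ENNReal.add_le_add_iff_left hgfin).1 hgi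
    have hle : ν ≤ p := by
      rw [hsum]
      exact Measure.le_add_right le_rfl
    refine ⟨ν, hνf, fun ξ => ?_, ?_⟩
    · have hint : ∀ m : Measure (Space d), IsFiniteMeasure m →
          Integrable (fun x : Space d => Complex.exp (((inner ℝ x ξ : ℝ) : ℂ) * Complex.I)) m :=
        fun m _ => (integrable_const (1 : ℝ)).mono (by fun_prop)
          (by simp [Complex.norm_exp_ofReal_mul_I])
      have h1 : charFun p ξ = charFun ν ξ + charFun ρ ξ := by
        rw [charFun_apply, charFun_apply, charFun_apply,
          ← integral_add_measure (hint ν hνf) (hint ρ hρf), ← hsum]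
      rw [h1, sub_add_cancel_left, norm_neg]
      refine (norm_charFun_le ξ).trans ?_
      exact ENNReal.toReal_le_of_le_ofReal hpos.le hρle
    · refine (le_energy_of_upperSemicontinuous hγ hg hN hR ν hν).trans ?_
      calc _ ≤ ∫⁻ y, ∫⁻ x, γ (x - y) ∂p ∂ν := lintegral_mono fun y => lintegral_mono' hle le_rfl
        _ ≤ _ := lintegral_mono' hle le_rfl
  choose ν hνf hνc hνe using hex
  calc _ = ENNReal.ofReal (inversionConst d) *
        ∫⁻ ξ, liminf (fun n => ‖charFun (ν n) ξ‖ₑ ^ 2) atTop ∂spectralMeasure γhat := by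
        congr 1
        refine lintegral_congr fun ξ => ?_
        have h1 : Tendsto (fun n => charFun (ν n) ξ) atTop (𝓝 (charFun p ξ)) := by
          rw [tendsto_iff_norm_sub_tendsto_zero]
          exact squeeze_zero (fun _ => norm_nonneg _) (fun n => hνc n ξ)
            tendsto_one_div_add_atTop_nhds_zero_nat
        exact (ENNReal.Tendsto.pow (n := 2) h1.enorm).liminf_eq.symm
    _ ≤ ENNReal.ofReal (inversionConst d) *
        liminf (fun n => ∫⁻ ξ, ‖charFun (ν n) ξ‖ₑ ^ 2 ∂spectralMeasure γhat) atTop := by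
        gcongr
        exact lintegral_liminf_le fun n => by fun_prop
    _ = liminf (fun n => ENNReal.ofReal (inversionConst d) *
        ∫⁻ ξ, ‖charFun (ν n) ξ‖ₑ ^ 2 ∂spectralMeasure γhat) atTop :=
        (ENNReal.liminf_const_mul_of_ne_top (by simp)).symm
    _ ≤ _ := liminf_le_of_frequently_le' (Frequently.of_forall hνe)

end Energy

section LevyKernel

variable {Ω : Type*} [MeasurableSpace Ω] {P : Measure Ω} {d : ℕ}
  {X : ℝ≥0 → Ω → Space d} {Ψ : Space d → ℝ} {γ : Space d → ℝ≥0∞} {γhat : Space d → ℝ}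

lemma enorm_charFun_levy (hΨ : IsCharExponent X P Ψ) (u : ℝ≥0) (ξ : Space d) :
    ‖charFun (P.map (X u)) ξ‖ₑ = ENNReal.ofReal (Real.exp (-(u : ℝ) * Ψ ξ)) := by
  rw [← ofReal_norm, hΨ, Complex.norm_exp_ofReal]

variable [IsProbabilityMeasure P]

/-- The spectral integral `(2π)^(-d) ∫ exp (-u Ψ(ξ)) μ(dξ)`, which turns out to be `E γ(X_u)`. -/
noncomputable def spectralMean (Ψ : Space d → ℝ) (γhat : Space d → ℝ) (u : ℝ) : ℝ≥0∞ :=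
  ENNReal.ofReal (inversionConst d) *
    ∫⁻ ξ, ENNReal.ofReal (Real.exp (-u * Ψ ξ)) ∂spectralMeasure γhat

lemma charExponent_nonneg (hX : IsSymmetricLevyProcess X P) (hΨ : IsCharExponent X P Ψ)
    (ξ : Space d) : 0 ≤ Ψ ξ := by
  have : IsProbabilityMeasure (P.map (X 1)) :=
    Measure.isProbabilityMeasure_map (hX.measurable 1).aemeasurable
  have h := norm_charFun_le_one (μ := P.map (X 1)) ξ
  rw [hΨ 1 ξ, Complex.norm_exp_ofReal, Real.exp_le_one_iff] at h
  simpa using h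

lemma measurable_charExponent (hX : IsSymmetricLevyProcess X P) (hΨ : IsCharExponent X P Ψ) :
    Measurable Ψ := by
  have : IsProbabilityMeasure (P.map (X 1)) :=
    Measure.isProbabilityMeasure_map (hX.measurable 1).aemeasurable
  have h : Ψ = fun ξ => -Real.log ‖charFun (P.map (X 1)) ξ‖ := by
    ext ξ
    rw [hΨ 1 ξ, Complex.norm_exp_ofReal, Real.log_exp]
    simp
  rw [h]
  exact (Real.measurable_log.comp (by fun_prop)).neg

/-- The mean of the kernel along the process started at any point is at most the spectral mean. -/
lemma lintegral_kernel_levy_le (hX : IsSymmetricLevyProcess X P) (hΨ : IsCharExponent X P Ψ)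
    (hγ : IsAdmissibleKernel γ γhat) (u : ℝ≥0) (x : Space d) :
    ∫⁻ y, γ (x + y) ∂(P.map (X u)) ≤ spectralMean Ψ γhat u := by
  have : IsProbabilityMeasure (P.map (X u)) :=
    Measure.isProbabilityMeasure_map (hX.measurable u).aemeasurable
  have h := lintegral_kernel_le hγ (Measure.dirac x ∗ P.map (X u))
  rw [Measure.lintegral_conv hγ.continuous.measurable, lintegral_dirac'] at h
  · refine h.trans ?_
    rw [spectralMean]
    gcongr with ξ
    rw [charFun_conv, charFun_dirac, enorm_mul, ← enorm_charFun_levy hΨ,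
      ← ofReal_norm (Complex.exp _), Complex.norm_exp_ofReal_mul_I]
    simp
  · exact Measurable.lintegral_prod_right' (f := fun p : Space d × Space d => γ (p.1 + p.2))
      (by have := hγ.continuous.measurable; fun_prop)

/-- By symmetry the law of `X u` is the law of the difference of two independent copies of
`X (u / 2)`; its kernel mean is therefore an interaction energy. -/
lemma lintegral_kernel_levy (hX : IsSymmetricLevyProcess X P) (hq : HasTransitionDensities X P)
    (hΨ : IsCharExponent X P Ψ)
    (hγ : IsAdmissibleKernel γ γhat) (u : ℝ≥0) (hu : 0 < u) :
    ∫⁻ y, γ y ∂(P.map (X u)) = spectralMean Ψ γhat u := by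
  refine le_antisymm (by simpa using lintegral_kernel_levy_le hX hΨ hγ u 0) ?_
  have hγm := hγ.continuous.measurable
  have hprob : ∀ v, IsProbabilityMeasure (P.map (X v)) := fun v =>
    Measure.isProbabilityMeasure_map (hX.measurable v).aemeasurable
  set p := P.map (X (u / 2)) with hp
  have hpp := hprob (u / 2)
  have h := le_energy hγ p (hq _ (by positivity))
  have hlaw : P.map (X u) = (p.map fun x => -x) ∗ p := by
    refine Measure.ext_of_charFun (funext fun ξ => ?_)
    rw [charFun_conv, charFun_map_neg, hp, hΨ, hΨ, ← Complex.exp_conj, Complex.conj_ofReal,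
      ← Complex.exp_add]
    push_cast
    ring_nf
  have henergy : ∫⁻ y, γ y ∂(P.map (X u)) = ∫⁻ y, ∫⁻ x, γ (x - y) ∂p ∂p := by
    rw [hlaw, Measure.lintegral_conv hγm, lintegral_map _ measurable_neg]
    · simp_rw [neg_add_eq_sub]
    · exact Measurable.lintegral_prod_right' (f := fun p : Space d × Space d => γ (p.1 + p.2))
        (by fun_prop)
  rw [henergy]
  refine le_of_eq_of_le ?_ h
  rw [spectralMean]
  congr 1
  refine lintegral_congr fun ξ => ?_
  rw [hp, enorm_charFun_levy hΨ, ← ENNReal.ofReal_pow (Real.exp_pos _).le, ← Real.exp_nat_mul]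
  congr 2
  push_cast
  ring

end LevyKernel

/-! ### Time integrals and Hypothesis (I) -/

section TimeIntegral

/-- The singular time weight `u ↦ u^(-β₀)`. -/
noncomputable def timeWeight (β₀ : ℝ) (u : ℝ) : ℝ≥0∞ := ENNReal.ofReal u ^ (-β₀)

@[fun_prop]
lemma measurable_timeWeight (β₀ : ℝ) : Measurable (timeWeight β₀) := by
  unfold timeWeight; fun_prop

lemma timeWeight_of_pos (β₀ : ℝ) {u : ℝ} (hu : 0 < u) :
    timeWeight β₀ u = ENNReal.ofReal (u ^ (-β₀)) := ENNReal.ofReal_rpow_of_pos hu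

lemma timeWeight_anti {β₀ : ℝ} (hβ₀ : 0 ≤ β₀) {u v : ℝ} (huv : u ≤ v) :
    timeWeight β₀ v ≤ timeWeight β₀ u := by
  rw [timeWeight, timeWeight, ENNReal.rpow_neg, ENNReal.rpow_neg, ENNReal.inv_le_inv]
  exact ENNReal.rpow_le_rpow (ENNReal.ofReal_le_ofReal huv) hβ₀

variable {β₀ : ℝ}

/-- On `(0, t]` the factor `exp (t - u)` is at least `1`. Inserting it replaces `ψ` by `1 + ψ` and
makes the Gamma integral over the half-line available also for `ψ = 0`. -/
lemma lintegral_timeWeight_exp_le (hβ₀ : β₀ ∈ Set.Ioo (0 : ℝ) 1) (t : ℝ) {ψ : ℝ} (hψ : 0 ≤ ψ) :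
    ∫⁻ u in Set.Ioc 0 t, timeWeight β₀ u * ENNReal.ofReal (Real.exp (-u * ψ))
      ≤ ENNReal.ofReal (Real.exp t * (2 * Real.Gamma (1 - β₀))) *
        ENNReal.ofReal (1 / (1 + ψ ^ (1 - β₀))) := by
  have ha : 0 < 1 - β₀ := by linarith [hβ₀.2]
  have hΓ := Real.Gamma_pos_of_pos ha
  have h1ψ : 0 < 1 + ψ := by linarith
  have hint : IntegrableOn (fun u : ℝ => u ^ (1 - β₀ - 1) * Real.exp (-((1 + ψ) * u)))
      (Set.Ioi 0) := by
    have := integrableOn_rpow_mul_exp_neg_mul_rpow (s := 1 - β₀ - 1) (p := 1) (b := 1 + ψ)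
      (by linarith) one_pos h1ψ
    simpa only [Real.rpow_one, neg_mul] using this
  have hval := Real.integral_rpow_mul_exp_neg_mul_Ioi ha h1ψ
  calc ∫⁻ u in Set.Ioc 0 t, timeWeight β₀ u * ENNReal.ofReal (Real.exp (-u * ψ))
      ≤ ∫⁻ u in Set.Ioc 0 t, ENNReal.ofReal (Real.exp t) *
        ENNReal.ofReal (u ^ (1 - β₀ - 1) * Real.exp (-((1 + ψ) * u))) := by
        refine setLIntegral_mono' measurableSet_Ioc fun u hu => ?_
        have hup : 0 ≤ u ^ (-β₀) := Real.rpow_nonneg hu.1.le _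
        rw [timeWeight_of_pos _ hu.1, ← ENNReal.ofReal_mul hup,
          ← ENNReal.ofReal_mul (Real.exp_pos _).le]
        refine ENNReal.ofReal_le_ofReal ?_
        have h1 : 1 - β₀ - 1 = -β₀ := by ring
        rw [h1]
        have h2 : Real.exp (-u * ψ) ≤ Real.exp t * Real.exp (-((1 + ψ) * u)) := by
          rw [← Real.exp_add]
          exact Real.exp_le_exp.2 (by linarith [hu.2])
        nlinarith
    _ ≤ ∫⁻ u in Set.Ioi 0, ENNReal.ofReal (Real.exp t) *
        ENNReal.ofReal (u ^ (1 - β₀ - 1) * Real.exp (-((1 + ψ) * u))) :=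
        lintegral_mono_set Set.Ioc_subset_Ioi_self
    _ = ENNReal.ofReal (Real.exp t) *
        ENNReal.ofReal ((1 / (1 + ψ)) ^ (1 - β₀) * Real.Gamma (1 - β₀)) := by
        rw [lintegral_const_mul' _ _ (by simp), ← hval, ofReal_integral_eq_lintegral_ofReal hint]
        exact (ae_restrict_mem measurableSet_Ioi).mono fun u (hu : 0 < u) =>
          mul_nonneg (Real.rpow_nonneg hu.le _) (Real.exp_pos _).le
    _ ≤ _ := by
        rw [← ENNReal.ofReal_mul (Real.exp_pos _).le, ← ENNReal.ofReal_mul (by positivity)]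
        refine ENNReal.ofReal_le_ofReal ?_
        have hψa : 0 ≤ ψ ^ (1 - β₀) := Real.rpow_nonneg hψ _
        have h1 : 1 ≤ (1 + ψ) ^ (1 - β₀) := Real.one_le_rpow (by linarith) ha.le
        have h2 : ψ ^ (1 - β₀) ≤ (1 + ψ) ^ (1 - β₀) :=
          Real.rpow_le_rpow hψ (by linarith) ha.le
        have h3 : (1 / (1 + ψ)) ^ (1 - β₀) ≤ 2 * (1 / (1 + ψ ^ (1 - β₀))) := by
          rw [Real.div_rpow zero_le_one h1ψ.le, Real.one_rpow, mul_one_div,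
            div_le_div_iff₀ (by linarith) (by linarith)]
          linarith
        calc _ ≤ Real.exp t * (2 * (1 / (1 + ψ ^ (1 - β₀))) * Real.Gamma (1 - β₀)) := by gcongr
          _ = _ := by ring

lemma le_lintegral_timeWeight_exp (hβ₀ : β₀ ∈ Set.Ioo (0 : ℝ) 1) {t : ℝ} (ht : 0 < t) {ψ : ℝ}
    (hψ : 0 ≤ ψ) :
    ENNReal.ofReal (Real.exp (-1) * (t ^ (1 - β₀) / (1 + t ^ (1 - β₀)))) *
        ENNReal.ofReal (1 / (1 + ψ ^ (1 - β₀)))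
      ≤ ∫⁻ u in Set.Ioc 0 t, timeWeight β₀ u * ENNReal.ofReal (Real.exp (-u * ψ)) := by
  have ha : 0 < 1 - β₀ := by linarith [hβ₀.2]
  have htψ : 0 < 1 + t * ψ := by positivity
  -- On `(0, s]` the exponential factor is at least `exp (-1)`, and `s` is comparable with the
  -- minimum of `t` and `1 / ψ`.
  set s := t / (1 + t * ψ) with hs
  have hs0 : 0 < s := by positivity
  have hst : s ≤ t := div_le_self ht.le (by nlinarith [mul_nonneg ht.le hψ])
  have hsψ : s * ψ ≤ 1 := by
    rw [hs, div_mul_eq_mul_div, div_le_one htψ]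
    linarith
  have hψa : 0 ≤ ψ ^ (1 - β₀) := Real.rpow_nonneg hψ _
  have hta : 0 < t ^ (1 - β₀) := Real.rpow_pos_of_pos ht _
  calc _ ≤ ENNReal.ofReal (s * (s ^ (-β₀) * Real.exp (-1))) := by
        rw [← ENNReal.ofReal_mul (by positivity)]
        refine ENNReal.ofReal_le_ofReal ?_
        have h1 : s * s ^ (-β₀) = t ^ (1 - β₀) / (1 + t * ψ) ^ (1 - β₀) := by
          rw [← Real.div_rpow ht.le htψ.le, ← hs, sub_eq_add_neg, Real.rpow_add hs0, Real.rpow_one]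
        have h2 : (1 + t * ψ) ^ (1 - β₀) ≤ (1 + t ^ (1 - β₀)) * (1 + ψ ^ (1 - β₀)) := by
          have := Real.rpow_add_le_add_rpow zero_le_one (mul_nonneg ht.le hψ) ha.le
            (by linarith [hβ₀.1] : 1 - β₀ ≤ 1)
          rw [Real.one_rpow, Real.mul_rpow ht.le hψ] at this
          nlinarith
        rw [← mul_assoc, h1, mul_assoc, mul_comm]
        refine mul_le_mul_of_nonneg_right ?_ (Real.exp_pos _).le
        rw [div_mul_div_comm, mul_one]
        exact div_le_div_of_nonneg_left hta.le (Real.rpow_pos_of_pos htψ _) h2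
    _ = ∫⁻ _ in Set.Ioc 0 s, ENNReal.ofReal (s ^ (-β₀) * Real.exp (-1)) := by
        rw [setLIntegral_const, Real.volume_Ioc, sub_zero, mul_comm,
          ENNReal.ofReal_mul (by positivity)]
    _ ≤ ∫⁻ u in Set.Ioc 0 s, timeWeight β₀ u * ENNReal.ofReal (Real.exp (-u * ψ)) := by
        refine setLIntegral_mono' measurableSet_Ioc fun u hu => ?_
        rw [ENNReal.ofReal_mul (by positivity), ← timeWeight_of_pos _ hs0]
        gcongr
        · exact timeWeight_anti hβ₀.1.le hu.2
        · nlinarith [mul_le_mul_of_nonneg_right hu.2 hψ]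
    _ ≤ _ := lintegral_mono_set (Set.Ioc_subset_Ioc_right hst)

variable {d : ℕ} {Ψ : Space d → ℝ} {γhat : Space d → ℝ}

lemma measurable_spectralMean (hΨm : Measurable Ψ) : Measurable (spectralMean Ψ γhat) := by
  have : SigmaFinite (spectralMeasure γhat) := by unfold spectralMeasure; infer_instance
  unfold spectralMean
  exact (Measurable.lintegral_prod_right'
    (f := fun p : ℝ × Space d => ENNReal.ofReal (Real.exp (-p.1 * Ψ p.2)))
      (by fun_prop)).const_mul _

/-- Integrating the spectral means against the time weight up to any fixed positive time gives a
finite number exactly under Hypothesis (I). -/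
lemma lintegral_timeWeight_spectralMean_lt_top_iff (hβ₀ : β₀ ∈ Set.Ioo (0 : ℝ) 1)
    (hΨm : Measurable Ψ) (hΨ0 : ∀ ξ, 0 ≤ Ψ ξ) {t : ℝ} (ht : 0 < t) :
    ∫⁻ u in Set.Ioc 0 t, timeWeight β₀ u * spectralMean Ψ γhat u < ∞
      ↔ HypothesisI β₀ Ψ (spectralMeasure γhat) := by
  have hσ : SigmaFinite (spectralMeasure γhat) := by unfold spectralMeasure; infer_instance
  have hc : 0 < ENNReal.ofReal (inversionConst d) := by simpa using inversionConst_pos d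
  have ha : 0 < 1 - β₀ := by linarith [hβ₀.2]
  have hΓ := Real.Gamma_pos_of_pos ha
  have heq : ∫⁻ u in Set.Ioc 0 t, timeWeight β₀ u * spectralMean Ψ γhat u
      = ENNReal.ofReal (inversionConst d) * ∫⁻ ξ, (∫⁻ u in Set.Ioc 0 t,
        timeWeight β₀ u * ENNReal.ofReal (Real.exp (-u * Ψ ξ))) ∂spectralMeasure γhat := by
    rw [lintegral_lintegral_swap (by unfold Function.uncurry; fun_prop),
      ← lintegral_const_mul' _ _ (by simp)]
    refine lintegral_congr fun u => ?_
    rw [spectralMean, lintegral_const_mul _ (by fun_prop)]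
    ring
  have hmeas : Measurable fun ξ => ENNReal.ofReal (1 / (1 + Ψ ξ ^ (1 - β₀))) := by fun_prop
  rw [heq, HypothesisI]
  constructor
  · intro h
    have h1 : ∫⁻ ξ, (∫⁻ u in Set.Ioc 0 t,
        timeWeight β₀ u * ENNReal.ofReal (Real.exp (-u * Ψ ξ))) ∂spectralMeasure γhat < ∞ :=
      ENNReal.lt_top_of_mul_ne_top_right h.ne hc.ne'
    have h2 := (lintegral_mono fun ξ => le_lintegral_timeWeight_exp hβ₀ ht (hΨ0 ξ)).trans_lt h1
    rw [lintegral_const_mul _ hmeas] at h2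
    refine ENNReal.lt_top_of_mul_ne_top_right h2.ne ?_
    have : 0 < t ^ (1 - β₀) := Real.rpow_pos_of_pos ht _
    simp only [ne_eq, ENNReal.ofReal_eq_zero, not_le]
    positivity
  · intro h
    refine ENNReal.mul_lt_top (by simp) ?_
    refine (lintegral_mono fun ξ => lintegral_timeWeight_exp_le hβ₀ t (hΨ0 ξ)).trans_lt ?_
    rw [lintegral_const_mul _ hmeas]
    exact ENNReal.mul_lt_top (by simp) h

/-- Exponential discounting makes a finite time integral arbitrarily small. -/
lemma exists_discount_lt {f : ℝ → ℝ≥0∞} (hf : Measurable f) {t : ℝ}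
    (hfi : ∫⁻ u in Set.Ioc 0 t, f u < ∞) {ε : ℝ≥0∞} (hε : 0 < ε) :
    ∃ θ : ℝ, 0 ≤ θ ∧ ∫⁻ u in Set.Ioc 0 t, ENNReal.ofReal (Real.exp (-θ * u)) * f u < ε := by
  have hlim : Tendsto (fun n : ℕ => ∫⁻ u in Set.Ioc 0 t,
      ENNReal.ofReal (Real.exp (-(n : ℝ) * u)) * f u) atTop (𝓝 (∫⁻ _ in Set.Ioc 0 t, 0)) := by
    refine tendsto_lintegral_of_dominated_convergence f (fun n => by fun_prop) (fun n => ?_)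
      hfi.ne ?_
    · filter_upwards [ae_restrict_mem measurableSet_Ioc] with u hu
      refine mul_le_of_le_one_left' (ENNReal.ofReal_le_one.2 (Real.exp_le_one_iff.2 ?_))
      have := hu.1
      have : (0 : ℝ) ≤ n * u := by positivity
      linarith
    · filter_upwards [ae_restrict_mem measurableSet_Ioc, ae_lt_top hf hfi.ne] with u hu hfu
      have h1 : Tendsto (fun n : ℕ => Real.exp (-(n : ℝ) * u)) atTop (𝓝 0) := by
        refine Real.tendsto_exp_atBot.comp ?_
        have := (tendsto_natCast_atTop_atTop (R := ℝ)).atTop_mul_const hu.1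
        simpa [Function.comp_def] using tendsto_neg_atTop_atBot.comp this
      have h2 := ENNReal.Tendsto.mul_const (b := f u) (ENNReal.tendsto_ofReal h1)
        (Or.inr hfu.ne)
      simpa using h2
  rw [lintegral_zero] at hlim
  obtain ⟨n, hn⟩ := (hlim.eventually_lt_const hε).exists
  exact ⟨n, n.cast_nonneg, hn⟩

end TimeIntegral

/-! ### Joint measurability and independence of increments -/

section Paths

variable {Ω : Type*} [MeasurableSpace Ω] {P : Measure Ω} {d : ℕ} {X Y : ℝ≥0 → Ω → Space d}

/-- Measurable approximation of times from the right by countably many values: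
`(⌊(n + 1) t⌋ + 1) / (n + 1) → t`. -/
lemma exists_countable_approx_right :
    ∃ (F : ℕ → ℕ → ℝ≥0) (G : ℕ → ℝ≥0 → ℕ), (∀ n, Measurable (G n)) ∧
      ∀ t, Tendsto (fun n => F n (G n t)) atTop (𝓝[Set.Ici t] t) := by
  refine ⟨fun n k => ((k : ℝ≥0) + 1) / ((n : ℝ≥0) + 1), fun n t => ⌊((n : ℝ≥0) + 1) * t⌋₊,
    fun n => Nat.measurable_floor.comp (measurable_const.mul measurable_id), fun t => ?_⟩
  have hle : ∀ n : ℕ, t ≤ ((⌊((n : ℝ≥0) + 1) * t⌋₊ : ℝ≥0) + 1) / ((n : ℝ≥0) + 1) := fun n => by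
    have h0 : (0 : ℝ≥0) < (n : ℝ≥0) + 1 := by positivity
    rw [le_div_iff₀ h0, mul_comm]
    exact (Nat.lt_floor_add_one _).le
  have hup : ∀ n : ℕ, ((⌊((n : ℝ≥0) + 1) * t⌋₊ : ℝ≥0) + 1) / ((n : ℝ≥0) + 1)
      ≤ t + 1 / ((n : ℝ≥0) + 1) := fun n => by
    have h0 : (0 : ℝ≥0) < (n : ℝ≥0) + 1 := by positivity
    rw [div_le_iff₀ h0, add_mul t, div_mul_cancel₀ _ h0.ne', mul_comm t]
    exact add_le_add_left (Nat.floor_le zero_le) 1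
  refine tendsto_nhdsWithin_iff.2 ⟨?_, Eventually.of_forall hle⟩
  have hlim : Tendsto (fun n : ℕ => t + 1 / ((n : ℝ≥0) + 1)) atTop (𝓝 t) := by
    have : Tendsto (fun n : ℕ => t + 1 / ((n : ℝ≥0) + 1)) atTop (𝓝 (t + 0)) :=
      tendsto_const_nhds.add tendsto_one_div_add_atTop_nhds_zero_nat
    rwa [add_zero] at this
  exact tendsto_of_tendsto_of_tendsto_of_le_of_le tendsto_const_nhds hlim hle hup

/-- A process with right-continuous paths is jointly measurable. -/
lemma measurable_uncurry_of_rightContinuous (hm : ∀ t, Measurable (X t))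
    (hc : ∀ ω t, ContinuousWithinAt (fun s => X s ω) (Set.Ici t) t) :
    Measurable (Function.uncurry X) := by
  obtain ⟨F, G, hG, hlim⟩ := exists_countable_approx_right
  refine measurable_of_tendsto_metrizable (f := fun n (p : ℝ≥0 × Ω) => X (F n (G n p.1)) p.2)
    (fun n => ?_) (tendsto_pi_nhds.2 fun p => (hc p.2 p.1).tendsto.comp (hlim p.1))
  have h1 : Measurable fun q : ℕ × Ω => X (F n q.1) q.2 :=
    measurable_from_prod_countable_right fun k => hm (F n k)
  have h2 : Measurable fun p : ℝ≥0 × Ω => (G n p.1, p.2) :=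
    ((hG n).comp measurable_fst).prodMk measurable_snd
  exact h1.comp h2

/-- A Lévy process agrees almost surely, at all times at once, with a jointly measurable one: its
paths are replaced by `0` on a null set outside of which they are càdlàg. -/
lemma exists_measurable_modification (hX : IsSymmetricLevyProcess X P) :
    ∃ Y : ℝ≥0 → Ω → Space d, (∀ᵐ ω ∂P, ∀ t, Y t ω = X t ω) ∧
      Measurable (Function.uncurry Y) := by
  obtain ⟨A, hA, hAm, hA0⟩ := hX.cadlag.exists_measurable_mem
  have hYc : ∀ ω, ω ∈ A → ∀ t, A.indicator (X t) ω = X t ω := fun ω hω t =>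
    Set.indicator_of_mem hω _
  refine ⟨fun t => A.indicator (X t), ?_, ?_⟩
  · filter_upwards [hA] with ω hω t using hYc ω hω t
  · refine measurable_uncurry_of_rightContinuous (fun t => (hX.measurable t).indicator hAm) ?_
    intro ω t
    by_cases hω : ω ∈ A
    · simp_rw [hYc ω hω]
      exact (hA0 ω hω t).1
    · simp only [Set.indicator_of_notMem hω]
      exact continuousWithinAt_const

lemma IsSymmetricLevyProcess.congr (hX : IsSymmetricLevyProcess X P)
    (hY : ∀ t, Measurable (Y t)) (h : ∀ᵐ ω ∂P, ∀ t, Y t ω = X t ω) :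
    IsSymmetricLevyProcess Y P where
  measurable := hY
  start_zero := by
    filter_upwards [h, hX.start_zero] with ω h1 h2
    rw [h1, h2]
  indep_increments n t ht := by
    refine (hX.indep_increments n t ht).congr fun i => ?_
    filter_upwards [h] with ω h1
    rw [h1, h1]
  stationary_increments s u := by
    rw [Measure.map_congr (g := fun ω => X (s + u) ω - X s ω), hX.stationary_increments s u]
    · refine Measure.map_congr ?_
      filter_upwards [h] with ω h1 using (h1 u).symm
    · filter_upwards [h] with ω h1
      rw [h1, h1]
  cadlag := by
    filter_upwards [h, hX.cadlag] with ω h1 h2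
    simpa only [h1] using h2
  symm t := by
    rw [Measure.map_congr (g := fun ω => -X t ω), hX.symm t]
    · refine Measure.map_congr ?_
      filter_upwards [h] with ω h1 using (h1 t).symm
    · filter_upwards [h] with ω h1
      rw [h1]

/-- An increment is independent of the whole past of the process. -/
lemma indepFun_past_increment [IsProbabilityMeasure P] (hY : HasIndepIncrements Y P)
    (hm : ∀ t, Measurable (Y t)) (h0 : ∀ ω, Y 0 ω = 0) {w u : ℝ≥0} (hwu : w ≤ u) :
    IndepFun (fun ω (v : Set.Iic w) => Y v ω) (fun ω => Y u ω - Y w ω) P := by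
  refine IndepFun.process_indepFun (fun v => hm _) ((hm _).sub (hm _)) fun I => ?_
  -- The finitely many past times, together with `0` and `w`, are listed in increasing order and
  -- followed by `u`. The past is then a function of the increments along this list up to `w`.
  set S : Finset ℝ≥0 := insert 0 (insert w (I.image Subtype.val)) with hS
  have hSw : ∀ x ∈ S, x ≤ w := by
    intro x hx
    simp only [hS, Finset.mem_insert, Finset.mem_image] at hx
    rcases hx with rfl | rfl | ⟨v, -, rfl⟩
    · exact zero_le
    · exact le_rfl
    · exact v.2
  set L := S.sort (· ≤ ·) with hL
  have hmemL : ∀ x, x ∈ L ↔ x ∈ S := fun x => Finset.mem_sort _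
  have hpw : ∀ i j (hi : i < L.length) (hj : j < L.length), i ≤ j → L[i] ≤ L[j] := by
    intro i j hi hj hij
    exact (Finset.sortedLT_sort S).sortedLE.monotone_get (a := ⟨i, hi⟩) (b := ⟨j, hj⟩) hij
  set T : ℕ → ℝ≥0 := fun k => if h : k < L.length then L[k] else u with hT
  have hTlt : ∀ k (h : k < L.length), T k = L[k] := fun k h => by simp [hT, h]
  have hTge : ∀ k, ¬ k < L.length → T k = u := fun k h => by simp [hT, h]
  have hLw : ∀ k (h : k < L.length), L[k] ≤ w := fun k h =>
    hSw _ ((hmemL _).1 (List.getElem_mem h))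
  have hTmono : Monotone T := by
    intro i j hij
    by_cases hj : j < L.length
    · rw [hTlt i (hij.trans_lt hj), hTlt j hj]
      exact hpw _ _ _ _ hij
    · rw [hTge j hj]
      by_cases hi : i < L.length
      · rw [hTlt i hi]
        exact (hLw i hi).trans hwu
      · rw [hTge i hi]
  have hIS : ∀ i : I, ((i : Set.Iic w) : ℝ≥0) ∈ S := fun i =>
    Finset.mem_insert_of_mem (Finset.mem_insert_of_mem (Finset.mem_image_of_mem _ i.2))
  have hidx : ∀ x ∈ S, ∃ k, k < L.length ∧ T k = x := by
    intro x hx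
    obtain ⟨k, hk, hkx⟩ := List.getElem_of_mem ((hmemL x).2 hx)
    exact ⟨k, hk, by rw [hTlt k hk, hkx]⟩
  have hT0 : T 0 = 0 := by
    obtain ⟨k, -, hk⟩ := hidx 0 (by simp [hS])
    exact le_antisymm ((hTmono (Nat.zero_le k)).trans hk.le) zero_le
  obtain ⟨N, hN⟩ : ∃ N, L.length = N + 1 := by
    obtain ⟨k, hk, -⟩ := hidx 0 (by simp [hS])
    exact ⟨L.length - 1, by omega⟩
  have hTN : T N = w := by
    obtain ⟨k, hk, hkw⟩ := hidx w (by simp [hS])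
    refine le_antisymm ?_ (hkw.symm.le.trans (hTmono (by omega)))
    rw [hTlt N (by omega)]
    exact hLw _ _
  have hTN1 : T (N + 1) = u := hTge _ (by omega)
  have hind := (hY.nat hTmono).indepFun_finset (Finset.range N) {N} (by simp)
    (fun i => (hm _).sub (hm _))
  choose! k hk hkx using hidx
  have hkN : ∀ i : I, k i ≤ N := fun i => by
    have := hk i (hIS i)
    omega
  let Φ : (Finset.range N → Space d) → I → Space d := fun z i =>
    ∑ j ∈ Finset.range (k i), if h : j ∈ Finset.range N then z ⟨j, h⟩ else 0
  let Θ : (({N} : Finset ℕ) → Space d) → Space d := fun z => z ⟨N, by simp⟩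
  have hΦ : Measurable Φ := by
    refine measurable_pi_lambda _ fun i => Finset.measurable_sum _ fun j _ => ?_
    split_ifs <;> fun_prop
  have hΘ : Measurable Θ := measurable_pi_apply _
  have hcomp := hind.comp hΦ hΘ
  convert hcomp using 1
  · funext ω i
    have h1 : ∀ j ∈ Finset.range (k i), (if h : j ∈ Finset.range N then
        Y (T (j + 1)) ω - Y (T j) ω else 0) = Y (T (j + 1)) ω - Y (T j) ω := by
      intro j hj
      have := hkN i
      have h2 : j ∈ Finset.range N := by
        simp only [Finset.mem_range] at hj ⊢
        omega
      rw [dif_pos h2]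
    simp only [Function.comp_apply, Φ]
    rw [Finset.sum_congr rfl h1, Finset.sum_range_sub (fun j => Y (T j) ω), hT0, h0, sub_zero,
      hkx i (hIS i)]
  · funext ω
    simp only [Function.comp_apply, Θ, hTN, hTN1]

lemma hasIndepIncrements_shift (hX : HasIndepIncrements X P) (s : ℝ≥0) :
    HasIndepIncrements (fun u ω => X (s + u) ω - X s ω) P := by
  intro n t ht
  have := hX n (fun i => s + t i) fun i j hij => add_le_add_right (ht hij) s
  simpa using this

/-- The Markov property in the form of a conditional mean bound: given the increments after time `s`
up to time `s + w`, the mean of the kernel at a later time is at most the spectral mean over the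
elapsed time. -/
lemma lintegral_kernel_mul_past_le [IsProbabilityMeasure P] {Ψ : Space d → ℝ}
    {γ : Space d → ℝ≥0∞} {γhat : Space d → ℝ}
    (hX : IsSymmetricLevyProcess X P) (hΨ : IsCharExponent X P Ψ)
    (hγ : IsAdmissibleKernel γ γhat) (s : ℝ≥0) {w u : ℝ≥0} (hwu : w ≤ u) {h : Ω → ℝ≥0∞}
    (hh : Measurable[MeasurableSpace.comap
      (fun ω (v : Set.Iic w) => X (s + v) ω - X s ω) inferInstance] h) :
    ∫⁻ ω, γ (X (s + u) ω - X s ω) * h ω ∂P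
      ≤ spectralMean Ψ γhat (u - w : ℝ) * ∫⁻ ω, h ω ∂P := by
  have hγm := hγ.continuous.measurable
  have hm := hX.measurable
  set Y : ℝ≥0 → Ω → Space d := fun u ω => X (s + u) ω - X s ω with hY
  have hYm : ∀ t, Measurable (Y t) := fun t => (hm _).sub (hm _)
  have hpast : Measurable (fun ω (v : Set.Iic w) => Y v ω) := measurable_pi_lambda _ fun v => hYm _
  have hh' : Measurable h := hh.mono hpast.comap_le le_rfl
  have hind := indepFun_past_increment (hasIndepIncrements_shift hX.indep_increments s) hYm
    (fun ω => by simp) hwu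
  set D : Ω → Space d := fun ω => Y u ω - Y w ω with hD
  have hDm : Measurable D := (hYm _).sub (hYm _)
  have hW : Measurable[MeasurableSpace.comap (fun ω (v : Set.Iic w) => Y v ω) inferInstance]
      (fun ω => (Y w ω, h ω)) := by
    refine Measurable.prodMk ?_ hh
    have hev : Measurable fun z : Set.Iic w → Space d => z ⟨w, Set.self_mem_Iic⟩ :=
      measurable_pi_apply _
    exact hev.comp (comap_measurable fun ω (v : Set.Iic w) => Y v ω)
  have hind2 : IndepFun (fun ω => (Y w ω, h ω)) D P :=
    indep_of_indep_of_le_left hind hW.comap_le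
  have hpair : Measurable fun ω => (Y w ω, h ω) := (hYm w).prodMk hh'
  have hDlaw : P.map D = P.map (X (u - w)) := by
    rw [← hX.stationary_increments (s + w) (u - w)]
    congr 1
    funext ω
    simp only [hD, hY, add_assoc, add_tsub_cancel_of_le hwu]
    abel
  have : IsProbabilityMeasure (P.map D) := Measure.isProbabilityMeasure_map hDm.aemeasurable
  have : IsProbabilityMeasure (P.map fun ω => (Y w ω, h ω)) :=
    Measure.isProbabilityMeasure_map hpair.aemeasurable
  have hjoint := (indepFun_iff_map_prod_eq_prod_map_map hpair.aemeasurable hDm.aemeasurable).1 hind2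
  calc ∫⁻ ω, γ (Y u ω) * h ω ∂P
      = ∫⁻ q, γ (q.1.1 + q.2) * q.1.2 ∂(P.map fun ω => ((Y w ω, h ω), D ω)) := by
        rw [lintegral_map (by fun_prop) (hpair.prodMk hDm)]
        simp [hD]
    _ = ∫⁻ q, ∫⁻ z, γ (q.1 + z) * q.2 ∂P.map D ∂(P.map fun ω => (Y w ω, h ω)) := by
        rw [hjoint, lintegral_prod _ (by fun_prop)]
    _ ≤ ∫⁻ q, spectralMean Ψ γhat (u - w : ℝ) * q.2 ∂(P.map fun ω => (Y w ω, h ω)) := by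
        refine lintegral_mono fun q => ?_
        dsimp only
        rw [lintegral_mul_const _ (by fun_prop), hDlaw]
        gcongr
        have := lintegral_kernel_levy_le hX hΨ hγ (u - w) q.1
        rwa [NNReal.coe_sub hwu] at this
    _ = _ := by
        rw [lintegral_map (by fun_prop) hpair, lintegral_const_mul _ hh']

end Paths

/-! ### Iterated integrals and Khas'minskii's bound -/

section Simplex

/-- Comparison of a power of the total mass with an integral over the simplex on which the last
coordinate is the largest. Atoms are allowed, hence an inequality. -/
lemma measure_univ_pow_succ_le (ν : Measure ℝ) [IsFiniteMeasure ν] (n : ℕ) :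
    ν Set.univ ^ (n + 1) ≤ (n + 1) * ∫⁻ u, ν (Set.Iic u) ^ n ∂ν := by
  set π := Measure.pi (fun _ : Fin (n + 1) => ν) with hπ
  have hE : ∀ i : Fin (n + 1), π {x | ∀ j, x j ≤ x i} ≤ ∫⁻ u, ν (Set.Iic u) ^ n ∂ν := by
    intro i
    have hmp := measurePreserving_piFinSuccAbove (fun _ : Fin (n + 1) => ν) i
    set B : Set (ℝ × (Fin n → ℝ)) := {q | ∀ j, q.2 j ≤ q.1} with hB
    have hBm : MeasurableSet B := by
      have : B = ⋂ j, {q | q.2 j ≤ q.1} := by ext; simp [hB]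
      rw [this]
      exact MeasurableSet.iInter fun j => measurableSet_le (by fun_prop) measurable_fst
    have hsub : {x : Fin (n + 1) → ℝ | ∀ j, x j ≤ x i}
        ⊆ (MeasurableEquiv.piFinSuccAbove (fun _ => ℝ) i) ⁻¹' B := by
      intro x hx j
      exact hx _
    refine (measure_mono hsub).trans ?_
    rw [hπ, hmp.measure_preimage hBm.nullMeasurableSet, Measure.prod_apply hBm]
    refine le_of_eq (lintegral_congr fun u => ?_)
    have : Prod.mk u ⁻¹' B = Set.pi Set.univ fun _ : Fin n => Set.Iic u := by
      ext y
      simp [hB, Pi.le_def]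
    rw [this, Measure.pi_pi]
    simp
  have hcover : (Set.univ : Set (Fin (n + 1) → ℝ)) ⊆ ⋃ i, {x | ∀ j, x j ≤ x i} := by
    intro x _
    obtain ⟨i, hi⟩ := Finite.exists_max x
    exact Set.mem_iUnion.2 ⟨i, hi⟩
  calc ν Set.univ ^ (n + 1) = π Set.univ := by simp [hπ, Measure.pi_univ]
    _ ≤ ∑ i : Fin (n + 1), π {x | ∀ j, x j ≤ x i} :=
        (measure_mono hcover).trans ((measure_iUnion_le _).trans_eq (tsum_fintype _))
    _ ≤ ∑ _i : Fin (n + 1), ∫⁻ u, ν (Set.Iic u) ^ n ∂ν := Finset.sum_le_sum fun i _ => hE i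
    _ = _ := by simp

/-- The iterated integrals of `g` over the simplices `0 < u₁ ≤ ⋯ ≤ uₙ ≤ v`. -/
noncomputable def simplexIntegral (g : ℝ → ℝ≥0∞) : ℕ → ℝ → ℝ≥0∞
  | 0 => fun _ => 1
  | n + 1 => fun v => ∫⁻ u in Set.Ioc 0 v, g u * simplexIntegral g n u

lemma lintegral_Ioc_pow_le_simplexIntegral {g : ℝ → ℝ≥0∞} (hg : Measurable g) {t : ℝ}
    (hfin : ∫⁻ u in Set.Ioc 0 t, g u < ∞) (n : ℕ) :
    ∀ v ≤ t, (∫⁻ u in Set.Ioc 0 v, g u) ^ n ≤ n.factorial * simplexIntegral g n v := by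
  induction n with
  | zero => intro v _; simp [simplexIntegral]
  | succ n ih =>
    intro v hv
    set ν := (volume.restrict (Set.Ioc 0 v)).withDensity g with hν
    have huniv : ν Set.univ = ∫⁻ u in Set.Ioc 0 v, g u := by
      rw [hν, withDensity_apply _ MeasurableSet.univ, Measure.restrict_univ]
    have hfinv : ∫⁻ u in Set.Ioc 0 v, g u < ∞ :=
      (lintegral_mono_set (Set.Ioc_subset_Ioc_right hv)).trans_lt hfin
    have : IsFiniteMeasure ν := ⟨huniv ▸ hfinv⟩
    have hIic : ∀ u ≤ v, ν (Set.Iic u) = ∫⁻ u in Set.Ioc 0 u, g u := fun u hu => by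
      have hI : MeasurableSet (Set.Iic u) := measurableSet_Iic
      rw [hν, withDensity_apply _ hI, Measure.restrict_restrict hI]
      congr 2
      ext x
      simp only [Set.mem_inter_iff, Set.mem_Iic, Set.mem_Ioc]
      constructor
      · rintro ⟨h1, h2, h3⟩; exact ⟨h2, h1⟩
      · rintro ⟨h1, h2⟩; exact ⟨h2, h1, h2.trans hu⟩
    have hmono : Monotone fun u : ℝ => ν (Set.Iic u) := fun x y hxy =>
      measure_mono (Set.Iic_subset_Iic.2 hxy)
    calc (∫⁻ u in Set.Ioc 0 v, g u) ^ (n + 1) = ν Set.univ ^ (n + 1) := by rw [huniv]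
      _ ≤ (n + 1) * ∫⁻ u, ν (Set.Iic u) ^ n ∂ν := measure_univ_pow_succ_le ν n
      _ = (n + 1) * ∫⁻ u in Set.Ioc 0 v, g u * ν (Set.Iic u) ^ n := by
          rw [hν, lintegral_withDensity_eq_lintegral_mul _ hg (hmono.measurable.pow_const n)]
          rfl
      _ ≤ (n + 1) * ∫⁻ u in Set.Ioc 0 v, n.factorial * (g u * simplexIntegral g n u) := by
          refine mul_le_mul' le_rfl ?_
          refine setLIntegral_mono' measurableSet_Ioc fun u hu => ?_
          rw [hIic u hu.2, mul_left_comm]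
          gcongr
          exact ih u (hu.2.trans hv)
      _ = _ := by
          rw [lintegral_const_mul' _ _ (by simp), ← mul_assoc, Nat.factorial_succ, simplexIntegral]
          push_cast
          rfl

end Simplex

section Khasminskii

variable {Ω : Type*} [mΩ : MeasurableSpace Ω] {P : Measure Ω} {a : ℝ → ℝ≥0∞}
  {Z : ℝ → Ω → ℝ≥0∞} {k : ℝ → ℝ≥0∞} {𝓕 : ℝ → MeasurableSpace Ω}

lemma measurable_simplexIntegral (ha : Measurable a) (hZ : Measurable (Function.uncurry Z))
    (n : ℕ) :
    Measurable fun p : ℝ × Ω => simplexIntegral (fun u => a u * Z u p.2) n p.1 := by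
  induction n with
  | zero => exact measurable_const
  | succ n ih =>
    have hset : MeasurableSet {q : (ℝ × Ω) × ℝ | q.2 ∈ Set.Ioc 0 q.1.1} := by
      simp only [Set.mem_Ioc]
      exact (measurableSet_lt measurable_const measurable_snd).inter
        (measurableSet_le measurable_snd (by fun_prop))
    have h2 : Measurable fun q : (ℝ × Ω) × ℝ => a q.2 * Z q.2 q.1.2 *
        simplexIntegral (fun u => a u * Z u q.1.2) n q.2 := by
      have h3 : Measurable fun q : (ℝ × Ω) × ℝ => (q.2, q.1.2) := by fun_prop
      exact ((ha.comp measurable_snd).mul (hZ.comp h3)).mul (ih.comp h3)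
    have h4 := (h2.indicator hset).lintegral_prod_right' (ν := volume)
    convert h4 using 2 with p
    simp only [simplexIntegral]
    rw [← lintegral_indicator measurableSet_Ioc]
    rfl

/-- Tonelli for the recursion defining the iterated integrals. -/
lemma lintegral_mul_simplexIntegral_succ [SFinite P] (ha : Measurable a)
    (hZ : Measurable (Function.uncurry Z)) (n : ℕ) (v : ℝ) {f : Ω → ℝ≥0∞} (hf : Measurable f) :
    ∫⁻ ω, f ω * simplexIntegral (fun r => a r * Z r ω) (n + 1) v ∂P
      = ∫⁻ r in Set.Ioc 0 v, a r *
        ∫⁻ ω, f ω * (Z r ω * simplexIntegral (fun r => a r * Z r ω) n r) ∂P := by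
  have hS := measurable_simplexIntegral ha hZ n
  have hZ1 : ∀ r, Measurable (Z r) := fun r => hZ.comp measurable_prodMk_left
  have hJ : Measurable fun q : Ω × ℝ => a q.2 * Z q.2 q.1 *
      simplexIntegral (fun r => a r * Z r q.1) n q.2 :=
    ((ha.comp measurable_snd).mul (hZ.comp measurable_swap)).mul (hS.comp measurable_swap)
  calc _ = ∫⁻ ω, (∫⁻ r in Set.Ioc 0 v, f ω * (a r * Z r ω *
        simplexIntegral (fun r => a r * Z r ω) n r)) ∂P := by
        refine lintegral_congr fun ω => ?_
        have hJω : Measurable fun r => a r * Z r ω * simplexIntegral (fun r => a r * Z r ω) n r :=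
          hJ.comp (measurable_prodMk_left (x := ω))
        rw [simplexIntegral, lintegral_const_mul _ hJω]
    _ = ∫⁻ r in Set.Ioc 0 v, ∫⁻ ω, f ω * (a r * Z r ω *
        simplexIntegral (fun r => a r * Z r ω) n r) ∂P :=
        lintegral_lintegral_swap ((hf.comp measurable_fst).mul hJ).aemeasurable
    _ = _ := by
        refine lintegral_congr fun r => ?_
        have hSr : Measurable fun ω => simplexIntegral (fun r => a r * Z r ω) n r :=
          hS.comp (measurable_prodMk_left (x := r))
        have hm : Measurable fun ω => f ω * (Z r ω * simplexIntegral (fun r => a r * Z r ω) n r) :=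
          hf.mul ((hZ1 r).mul hSr)
        rw [← lintegral_const_mul _ hm]
        refine lintegral_congr fun ω => ?_
        ring

/-- A weight measurable with respect to the past factors out of the mean of the process at a later
time, at the cost of the kernel of the elapsed time; iterated integrals over the past may be
included in the weight. -/
lemma lintegral_mul_simplexIntegral_le [SFinite P] (ha : Measurable a)
    (hZ : Measurable (Function.uncurry Z))
    (hle : ∀ w, 𝓕 w ≤ mΩ) (hmono : Monotone 𝓕)
    (hadapt : ∀ w, Measurable[𝓕 w] (Z w))
    (hM : ∀ w u, 0 ≤ w → w ≤ u → ∀ h : Ω → ℝ≥0∞, Measurable[𝓕 w] h →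
      ∫⁻ ω, Z u ω * h ω ∂P ≤ k (u - w) * ∫⁻ ω, h ω ∂P) (n : ℕ) :
    ∀ v w u, v ≤ w → 0 ≤ w → w ≤ u → ∀ h : Ω → ℝ≥0∞, Measurable[𝓕 w] h →
      ∫⁻ ω, Z u ω * h ω * simplexIntegral (fun r => a r * Z r ω) n v ∂P
        ≤ k (u - w) * ∫⁻ ω, h ω * simplexIntegral (fun r => a r * Z r ω) n v ∂P := by
  induction n with
  | zero =>
    intro v w u _ hw hwu h hh
    simpa [simplexIntegral] using hM w u hw hwu h hh
  | succ n ih =>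
    intro v w u hvw hw hwu h hh
    have hh' : Measurable h := hh.mono (hle w) le_rfl
    have hS := measurable_simplexIntegral ha hZ n
    have hZ1 : ∀ r, Measurable (Z r) := fun r => hZ.comp measurable_prodMk_left
    have hZh : Measurable fun ω => Z u ω * h ω := (hZ1 u).mul hh'
    rw [lintegral_mul_simplexIntegral_succ ha hZ n v hZh,
      lintegral_mul_simplexIntegral_succ ha hZ n v hh']
    have hmeasr : Measurable fun r => a r *
        ∫⁻ ω, h ω * (Z r ω * simplexIntegral (fun r => a r * Z r ω) n r) ∂P :=
      ha.mul (Measurable.lintegral_prod_right'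
        (f := fun q : ℝ × Ω => h q.2 * (Z q.1 q.2 * simplexIntegral (fun r => a r * Z r q.2) n q.1))
        ((hh'.comp measurable_snd).mul (hZ.mul hS)))
    rw [← lintegral_const_mul _ hmeasr]
    refine setLIntegral_mono' measurableSet_Ioc fun r hr => ?_
    have := ih r w u (hr.2.trans hvw) hw hwu (fun ω => h ω * Z r ω)
      (hh.mul ((hadapt r).mono (hmono (hr.2.trans hvw)) le_rfl))
    rw [mul_left_comm]
    gcongr
    simpa only [mul_assoc] using this

/-- Moments of an additive functional: a Khas'minskii-type bound. The weight `a` depends on the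
absolute time and not on the elapsed one; being decreasing, it satisfies `a u ≤ a (u - v)`, which
turns the recursion for the iterated means into a convolution inequality. The discount
`exp (-θ u)` is multiplicative along the convolution. -/
lemma lintegral_simplexIntegral_le [IsProbabilityMeasure P] (ha : Measurable a)
    (haanti : Antitone a) (hk : Measurable k)
    (hZ : Measurable (Function.uncurry Z))
    (hle : ∀ w, 𝓕 w ≤ mΩ) (hmono : Monotone 𝓕)
    (hadapt : ∀ w, Measurable[𝓕 w] (Z w))
    (hM : ∀ w u, 0 ≤ w → w ≤ u → ∀ h : Ω → ℝ≥0∞, Measurable[𝓕 w] h →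
      ∫⁻ ω, Z u ω * h ω ∂P ≤ k (u - w) * ∫⁻ ω, h ω ∂P) {θ : ℝ} (hθ : 0 ≤ θ) {t : ℝ}
    (ht : 0 ≤ t) (n : ℕ) :
    ∫⁻ ω, simplexIntegral (fun r => a r * Z r ω) n t ∂P ≤ ENNReal.ofReal (Real.exp (θ * t)) *
      (∫⁻ u in Set.Ioc 0 t, ENNReal.ofReal (Real.exp (-θ * u)) * (a u * k u)) ^ n := by
  set κ := ∫⁻ u in Set.Ioc 0 t, ENNReal.ofReal (Real.exp (-θ * u)) * (a u * k u) with hκ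
  set e : ℝ → ℝ≥0∞ := fun u => ENNReal.ofReal (Real.exp (-θ * u)) with he
  have hem : Measurable e := by fun_prop
  have headd : ∀ u v, e u = e v * e (u - v) := fun u v => by
    rw [he, ← ENNReal.ofReal_mul (Real.exp_pos _).le, ← Real.exp_add]
    ring_nf
  have hS := measurable_simplexIntegral ha hZ
  have hZ1 : ∀ r, Measurable (Z r) := fun r => hZ.comp measurable_prodMk_left
  set b : ℕ → ℝ → ℝ≥0∞ := fun n u =>
    ∫⁻ ω, Z u ω * simplexIntegral (fun r => a r * Z r ω) n u ∂P with hb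
  have hbm : ∀ n, Measurable (b n) := fun n => Measurable.lintegral_prod_right'
    (f := fun q : ℝ × Ω => Z q.1 q.2 * simplexIntegral (fun r => a r * Z r q.2) n q.1)
    (hZ.mul (hS n))
  have hm3 : ∀ n, Measurable fun v => e v * (a v * b n v) := fun n => hem.mul (ha.mul (hbm n))
  have hbrec : ∀ n u, b (n + 1) u ≤ ∫⁻ v in Set.Ioc 0 u, a v * (k (u - v) * b n v) := by
    intro n u
    rw [hb]
    dsimp only
    rw [lintegral_mul_simplexIntegral_succ ha hZ n u (hZ1 u)]
    refine setLIntegral_mono' measurableSet_Ioc fun v hv => ?_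
    gcongr
    have := lintegral_mul_simplexIntegral_le (n := n) ha hZ hle hmono hadapt hM v v u le_rfl
      hv.1.le hv.2 (Z v) (hadapt v)
    simpa only [mul_assoc] using this
  have hint : ∀ n, ∫⁻ u in Set.Ioc 0 t, e u * (a u * b n u) ≤ κ ^ (n + 1) := by
    intro n
    induction n with
    | zero =>
      rw [zero_add, pow_one, hκ]
      refine setLIntegral_mono' measurableSet_Ioc fun u hu => ?_
      change e u * (a u * b 0 u) ≤ e u * (a u * k u)
      gcongr
      have := hM 0 u le_rfl hu.1.le (fun _ => 1) measurable_const
      simpa [hb, simplexIntegral] using this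
    | succ n ih =>
      calc ∫⁻ u in Set.Ioc 0 t, e u * (a u * b (n + 1) u)
          ≤ ∫⁻ u in Set.Ioc 0 t, ∫⁻ v in Set.Ioc 0 t,
            (e v * (a v * b n v)) * (Set.Ioc 0 t).indicator
              (fun r => e r * (a r * k r)) (u - v) := by
            refine setLIntegral_mono' measurableSet_Ioc fun u hu => ?_
            calc e u * (a u * b (n + 1) u)
                ≤ e u * (a u * ∫⁻ v in Set.Ioc 0 u, a v * (k (u - v) * b n v)) := by
                  gcongr
                  exact hbrec n u
              _ = ∫⁻ v in Set.Ioo 0 u, e u * (a u * (a v * (k (u - v) * b n v))) := by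
                  have hkm : Measurable fun v => k (u - v) :=
                    hk.comp (measurable_const.sub measurable_id)
                  have hm1 : Measurable fun v => a v * (k (u - v) * b n v) :=
                    ha.mul (hkm.mul (hbm n))
                  rw [restrict_Ioo_eq_restrict_Ioc, lintegral_const_mul _ (hm1.const_mul _),
                    lintegral_const_mul _ hm1]
              _ ≤ ∫⁻ v in Set.Ioo 0 u, (e v * (a v * b n v)) * (Set.Ioc 0 t).indicator
                  (fun r => e r * (a r * k r)) (u - v) := by
                  refine setLIntegral_mono' measurableSet_Ioo fun v hv => ?_
                  have hmem : u - v ∈ Set.Ioc 0 t :=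
                    ⟨sub_pos.2 hv.2, by linarith [hv.1, hu.2]⟩
                  rw [Set.indicator_of_mem hmem, headd u v]
                  calc e v * e (u - v) * (a u * (a v * (k (u - v) * b n v)))
                      ≤ e v * e (u - v) * (a (u - v) * (a v * (k (u - v) * b n v))) := by
                        gcongr
                        exact haanti (by linarith [hv.1])
                    _ = _ := by ring
              _ ≤ _ := lintegral_mono_set
                  (Set.Ioo_subset_Ioc_self.trans (Set.Ioc_subset_Ioc_right hu.2))
        _ = ∫⁻ v in Set.Ioc 0 t, (e v * (a v * b n v)) * ∫⁻ u in Set.Ioc 0 t,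
            (Set.Ioc 0 t).indicator (fun r => e r * (a r * k r)) (u - v) := by
            have hm2 : Measurable ((Set.Ioc 0 t).indicator fun r => e r * (a r * k r)) :=
              (hem.mul (ha.mul hk)).indicator measurableSet_Ioc
            have hm4 : Measurable fun q : ℝ × ℝ => (e q.2 * (a q.2 * b n q.2)) *
                (Set.Ioc 0 t).indicator (fun r => e r * (a r * k r)) (q.1 - q.2) :=
              ((hm3 n).comp measurable_snd).mul (hm2.comp (measurable_fst.sub measurable_snd))
            rw [lintegral_lintegral_swap hm4.aemeasurable]
            refine lintegral_congr fun v => ?_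
            have hm5 : Measurable fun u =>
                (Set.Ioc 0 t).indicator (fun r => e r * (a r * k r)) (u - v) :=
              hm2.comp (measurable_id.sub measurable_const)
            rw [lintegral_const_mul _ hm5]
        _ ≤ ∫⁻ v in Set.Ioc 0 t, (e v * (a v * b n v)) * κ := by
            refine lintegral_mono fun v => ?_
            gcongr
            calc _ ≤ ∫⁻ u, (Set.Ioc 0 t).indicator (fun r => e r * (a r * k r)) (u - v) :=
                  setLIntegral_le_lintegral _ _
              _ = κ := by
                  rw [lintegral_sub_right_eq_self, lintegral_indicator measurableSet_Ioc]
        _ ≤ _ := by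
            rw [lintegral_mul_const _ (hm3 n), pow_succ]
            gcongr
  cases n with
  | zero =>
    simp only [simplexIntegral, lintegral_const, measure_univ, pow_zero, mul_one]
    exact ENNReal.one_le_ofReal.2 (Real.one_le_exp (mul_nonneg hθ ht))
  | succ n =>
    have h1 := lintegral_mul_simplexIntegral_succ (P := P) ha hZ n t (f := fun _ => 1)
      measurable_const
    simp only [one_mul] at h1
    rw [h1]
    calc _ ≤ ∫⁻ u in Set.Ioc 0 t, ENNReal.ofReal (Real.exp (θ * t)) * (e u * (a u * b n u)) := by
          refine setLIntegral_mono' measurableSet_Ioc fun u hu => ?_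
          rw [← mul_assoc]
          refine le_mul_of_one_le_left' ?_
          rw [he, ← ENNReal.ofReal_mul (Real.exp_pos _).le, ← Real.exp_add]
          refine ENNReal.one_le_ofReal.2 (Real.one_le_exp ?_)
          nlinarith [hu.2]
      _ ≤ _ := by
          rw [lintegral_const_mul _ (hm3 n)]
          gcongr
          exact hint n

end Khasminskii

/-! ### Moments of the Hamiltonian -/

section Auxiliary

/-- Hölder's inequality against the constant function `1`. -/
lemma lintegral_pow_succ_le {α : Type*} [MeasurableSpace α] (μ : Measure α) {f : α → ℝ≥0∞}
    (hf : Measurable f) (n : ℕ) :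
    (∫⁻ x, f x ∂μ) ^ (n + 1) ≤ μ Set.univ ^ n * ∫⁻ x, f x ^ (n + 1) ∂μ := by
  rcases Nat.eq_zero_or_pos n with rfl | hn
  · simp
  have hp : 1 < ((n + 1 : ℕ) : ℝ) := by exact_mod_cast Nat.succ_lt_succ hn
  have h := ENNReal.lintegral_mul_le_Lp_mul_Lq μ (Real.HolderConjugate.conjExponent hp)
    hf.aemeasurable (aemeasurable_const (b := (1 : ℝ≥0∞)))
  simp only [Pi.mul_apply, mul_one, ENNReal.one_rpow, lintegral_const, one_mul,
    ENNReal.rpow_natCast] at h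
  have hn0 : ((n + 1 : ℕ) : ℝ) ≠ 0 := by positivity
  calc (∫⁻ x, f x ∂μ) ^ (n + 1)
      ≤ ((∫⁻ x, f x ^ (n + 1) ∂μ) ^ (1 / ((n + 1 : ℕ) : ℝ)) *
        μ Set.univ ^ (1 / (((n + 1 : ℕ) : ℝ).conjExponent))) ^ (n + 1) := by gcongr
    _ = _ := by
      rw [mul_pow, ← ENNReal.rpow_mul_natCast, ← ENNReal.rpow_mul_natCast,
        one_div_mul_cancel hn0, ENNReal.rpow_one, mul_comm, ← ENNReal.rpow_natCast _ n]
      congr 2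
      rw [Real.conjExponent]
      have : (n : ℝ) ≠ 0 := by positivity
      push_cast
      field_simp
      ring

lemma EReal_exp_coe_eq_tsum {x : ℝ≥0∞} (hx : x ≠ ∞) :
    EReal.exp (x : EReal) = ∑' n : ℕ, x ^ n / n.factorial := by
  obtain ⟨y, rfl⟩ : ∃ y : ℝ≥0, x = y := ⟨x.toNNReal, (ENNReal.coe_toNNReal hx).symm⟩
  have h1 : (((y : ℝ≥0∞)) : EReal) = ((y : ℝ) : EReal) := rfl
  have h2 : Real.exp y = ∑' n : ℕ, (y : ℝ) ^ n / n.factorial := by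
    rw [Real.exp_eq_exp_ℝ]
    exact (NormedSpace.expSeries_div_hasSum_exp (y : ℝ)).tsum_eq.symm
  rw [h1, EReal.exp_coe, h2, ENNReal.ofReal_tsum_of_nonneg (fun n => by positivity)
    (Real.summable_pow_div_factorial _)]
  refine tsum_congr fun n => ?_
  rw [ENNReal.ofReal_div_of_pos (by positivity), ENNReal.ofReal_pow (by positivity),
    ENNReal.ofReal_coe_nnreal, ENNReal.ofReal_natCast]

lemma le_EReal_exp_coe (x : ℝ≥0∞) : x ≤ EReal.exp (x : EReal) := by
  by_cases hx : x = ∞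
  · simp [hx]
  rw [EReal_exp_coe_eq_tsum hx]
  calc x = x ^ 1 / (1 : ℕ).factorial := by simp
    _ ≤ _ := ENNReal.le_tsum (f := fun n : ℕ => x ^ n / n.factorial) 1

/-- A symmetric kernel on a square is at most twice its integral over the part above the
diagonal, here written in terms of the increment `u = r - s`. -/
lemma lintegral_square_le_of_symm {F : ℝ → ℝ → ℝ≥0∞} (hF : Measurable (Function.uncurry F))
    (hsymm : ∀ s r, F s r = F r s) (t : ℝ) :
    ∫⁻ s in Set.Icc 0 t, ∫⁻ r in Set.Icc 0 t, F s r
      ≤ 2 * ∫⁻ s in Set.Icc 0 t, ∫⁻ u in Set.Ioc 0 t, F s (s + u) := by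
  set G : ℝ → ℝ → ℝ≥0∞ := fun s r => {q : ℝ × ℝ | q.1 ≤ q.2}.indicator (Function.uncurry F) (s, r)
    with hG
  have hGm : Measurable (Function.uncurry G) :=
    hF.indicator (measurableSet_le measurable_fst measurable_snd)
  have hFG : ∀ s r, F s r ≤ G s r + G r s := by
    intro s r
    rcases le_total s r with h | h
    · refine le_trans (le_of_eq ?_) le_self_add
      simp [hG, Set.indicator, h]
    · refine le_trans (le_of_eq ?_) le_add_self
      simp [hG, Set.indicator, h, hsymm s r]
  have hG1 : ∀ s, Measurable (G s) := fun s => hGm.comp measurable_prodMk_left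
  calc ∫⁻ s in Set.Icc 0 t, ∫⁻ r in Set.Icc 0 t, F s r
      ≤ ∫⁻ s in Set.Icc 0 t, ∫⁻ r in Set.Icc 0 t, (G s r + G r s) :=
        lintegral_mono fun s => lintegral_mono fun r => hFG s r
    _ = (∫⁻ s in Set.Icc 0 t, ∫⁻ r in Set.Icc 0 t, G s r)
        + ∫⁻ s in Set.Icc 0 t, ∫⁻ r in Set.Icc 0 t, G r s := by
        have hGi : Measurable fun s => ∫⁻ r in Set.Icc 0 t, G s r :=
          Measurable.lintegral_prod_right' hGm
        rw [← lintegral_add_left hGi]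
        refine lintegral_congr fun s => ?_
        rw [lintegral_add_left (hG1 s)]
    _ = 2 * ∫⁻ s in Set.Icc 0 t, ∫⁻ r in Set.Icc 0 t, G s r := by
        rw [two_mul]
        congr 1
        exact lintegral_lintegral_swap (hGm.comp measurable_swap).aemeasurable
    _ ≤ _ := by
        refine mul_le_mul' le_rfl (setLIntegral_mono' measurableSet_Icc fun s hs => ?_)
        calc ∫⁻ r in Set.Icc 0 t, G s r
            ≤ ∫⁻ r in Set.Icc 0 t, (Set.Icc 0 t).indicator (fun u => F s (s + u)) (r - s) := by
              refine setLIntegral_mono' measurableSet_Icc fun r hr => ?_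
              by_cases h : s ≤ r
              · have hmem : r - s ∈ Set.Icc 0 t := ⟨sub_nonneg.2 h, by linarith [hs.1, hr.2]⟩
                rw [Set.indicator_of_mem hmem]
                simp [hG, Set.indicator, h]
              · simp [hG, Set.indicator, h]
          _ ≤ ∫⁻ r, (Set.Icc 0 t).indicator (fun u => F s (s + u)) (r - s) :=
              setLIntegral_le_lintegral _ _
          _ = ∫⁻ u in Set.Icc 0 t, F s (s + u) := by
              rw [lintegral_sub_right_eq_self, lintegral_indicator measurableSet_Icc]
          _ = _ := by rw [restrict_Ioc_eq_restrict_Icc]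

end Auxiliary

section Hamiltonian

variable {Ω : Type*} [MeasurableSpace Ω] {P : Measure Ω} [IsProbabilityMeasure P] {d : ℕ}
  {X : ℝ≥0 → Ω → Space d} {Ψ : Space d → ℝ} {γ : Space d → ℝ≥0∞} {γhat : Space d → ℝ} {β₀ : ℝ}

/-- The functional `∫₀ᵗ u^(-β₀) γ(X_{s+u} - X_s) du` of the path after time `s`. -/
noncomputable def forwardFunctional (β₀ : ℝ) (γ : Space d → ℝ≥0∞) (X : ℝ≥0 → Ω → Space d)
    (t s : ℝ) (ω : Ω) : ℝ≥0∞ :=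
  ∫⁻ u in Set.Ioc 0 t, timeWeight β₀ u * γ (X (s.toNNReal + u.toNNReal) ω - X s.toNNReal ω)

/-- The quantity `∫₀ᵗ exp (-θ u) u^(-β₀) E γ(X_u) du` controlling the moments, which tends to `0`
as the discount rate `θ` grows, provided that it is finite for `θ = 0`. -/
noncomputable def discountedKernel (β₀ : ℝ) (Ψ : Space d → ℝ) (γhat : Space d → ℝ) (θ t : ℝ) :
    ℝ≥0∞ :=
  ∫⁻ u in Set.Ioc 0 t, ENNReal.ofReal (Real.exp (-θ * u)) *
    (timeWeight β₀ u * spectralMean Ψ γhat u)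

/-- The Khas'minskii-type bound for the path after time `s`, whose past is generated by the
increments `X_{s+v} - X_s`. -/
lemma lintegral_forwardFunctional_pow_le (hX : IsSymmetricLevyProcess X P)
    (hXm : Measurable (Function.uncurry X)) (hΨ : IsCharExponent X P Ψ)
    (hγ : IsAdmissibleKernel γ γhat) (hβ₀ : 0 ≤ β₀) {θ t : ℝ} (hθ : 0 ≤ θ) (ht : 0 ≤ t)
    (hκ : discountedKernel β₀ Ψ γhat θ t < ∞) (s : ℝ) (n : ℕ) :
    ∫⁻ ω, forwardFunctional β₀ γ X t s ω ^ n ∂P ≤ n.factorial *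
      (ENNReal.ofReal (Real.exp (θ * t)) * discountedKernel β₀ Ψ γhat θ t ^ n) := by
  have hγm := hγ.continuous.measurable
  have hΨm := measurable_charExponent hX hΨ
  set s' : ℝ≥0 := s.toNNReal
  set Z : ℝ → Ω → ℝ≥0∞ := fun u ω => γ (X (s' + u.toNNReal) ω - X s' ω) with hZdef
  set past : (w : ℝ) → Ω → (Set.Iic w.toNNReal → Space d) :=
    fun w ω v => X (s' + v) ω - X s' ω with hpast
  set 𝓕 : ℝ → MeasurableSpace Ω := fun w => MeasurableSpace.comap (past w) inferInstance with h𝓕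
  have hZ : Measurable (Function.uncurry Z) := by
    have h1 : Measurable fun q : ℝ × Ω => X (s' + q.1.toNNReal) q.2 :=
      hXm.comp (((measurable_const.add measurable_fst.real_toNNReal)).prodMk measurable_snd)
    have h2 : Measurable fun q : ℝ × Ω => X s' q.2 := (hX.measurable s').comp measurable_snd
    exact hγm.comp (h1.sub h2)
  have hpm : ∀ w, Measurable (past w) := fun w =>
    measurable_pi_lambda _ fun v => (hX.measurable _).sub (hX.measurable _)
  have hle : ∀ w, 𝓕 w ≤ _ := fun w => (hpm w).comap_le
  have hmono : Monotone 𝓕 := by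
    intro w w' hww'
    have hsub : ∀ v : Set.Iic w.toNNReal, (v : ℝ≥0) ∈ Set.Iic w'.toNNReal := fun v =>
      v.2.trans (Real.toNNReal_mono hww')
    have hres : Measurable fun (z : Set.Iic w'.toNNReal → Space d) (v : Set.Iic w.toNNReal) =>
        z ⟨v, hsub v⟩ := measurable_pi_lambda _ fun v => measurable_pi_apply _
    have : Measurable[𝓕 w'] (past w) := hres.comp (comap_measurable (past w'))
    exact this.comap_le
  have hadapt : ∀ w, Measurable[𝓕 w] (Z w) := by
    intro w
    have hev : Measurable fun z : Set.Iic w.toNNReal → Space d =>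
        z ⟨w.toNNReal, Set.self_mem_Iic⟩ := measurable_pi_apply _
    exact hγm.comp (hev.comp (comap_measurable (past w)))
  have hM : ∀ w u, 0 ≤ w → w ≤ u → ∀ h : Ω → ℝ≥0∞, Measurable[𝓕 w] h →
      ∫⁻ ω, Z u ω * h ω ∂P ≤ spectralMean Ψ γhat (u - w) * ∫⁻ ω, h ω ∂P := by
    intro w u hw hwu h hh
    have := lintegral_kernel_mul_past_le hX hΨ hγ s' (Real.toNNReal_mono hwu) hh
    rwa [Real.coe_toNNReal _ hw, Real.coe_toNNReal _ (hw.trans hwu)] at this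
  have hbound := lintegral_simplexIntegral_le (P := P) (measurable_timeWeight β₀)
    (fun u v huv => timeWeight_anti hβ₀ huv) (measurable_spectralMean hΨm) hZ hle hmono hadapt hM
    hθ ht
  have hmeasA : ∀ n, Measurable fun ω => simplexIntegral (fun u => timeWeight β₀ u * Z u ω) n t :=
    fun n => (measurable_simplexIntegral (measurable_timeWeight β₀) hZ n).comp
      (measurable_prodMk_left (x := t))
  have hA1 : ∀ ω, simplexIntegral (fun u => timeWeight β₀ u * Z u ω) 1 t
      = forwardFunctional β₀ γ X t s ω := fun ω => by
    simp only [simplexIntegral, mul_one]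
    rfl
  have hfin : ∀ᵐ ω ∂P, forwardFunctional β₀ γ X t s ω < ∞ := by
    have h1 : ∫⁻ ω, simplexIntegral (fun u => timeWeight β₀ u * Z u ω) 1 t ∂P < ∞ :=
      (hbound 1).trans_lt (ENNReal.mul_lt_top (by simp) (by rw [pow_one]; exact hκ))
    filter_upwards [ae_lt_top (hmeasA 1) h1.ne] with ω hω
    rwa [hA1] at hω
  calc ∫⁻ ω, forwardFunctional β₀ γ X t s ω ^ n ∂P
      ≤ ∫⁻ ω, n.factorial * simplexIntegral (fun u => timeWeight β₀ u * Z u ω) n t ∂P := by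
        refine lintegral_mono_ae ?_
        filter_upwards [hfin] with ω hω
        have hg : Measurable fun u => timeWeight β₀ u * Z u ω :=
          (measurable_timeWeight β₀).mul (hZ.comp measurable_prodMk_right)
        exact lintegral_Ioc_pow_le_simplexIntegral hg hω n t le_rfl
    _ = n.factorial * ∫⁻ ω, simplexIntegral (fun u => timeWeight β₀ u * Z u ω) n t ∂P :=
        lintegral_const_mul _ (hmeasA n)
    _ ≤ _ := by
        gcongr
        exact hbound n

lemma measurable_hamiltonian_integrand (hXm : Measurable (Function.uncurry X)) (hγm : Measurable γ)
    (β₀ : ℝ) : Measurable fun q : Ω × ℝ × ℝ => ENNReal.ofReal |q.2.2 - q.2.1| ^ (-β₀) *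
      γ (X q.2.2.toNNReal q.1 - X q.2.1.toNNReal q.1) := by
  have h1 : Measurable fun q : Ω × ℝ × ℝ => X q.2.2.toNNReal q.1 :=
    hXm.comp (f := fun q : Ω × ℝ × ℝ => (q.2.2.toNNReal, q.1)) (by fun_prop)
  have h2 : Measurable fun q : Ω × ℝ × ℝ => X q.2.1.toNNReal q.1 :=
    hXm.comp (f := fun q : Ω × ℝ × ℝ => (q.2.1.toNNReal, q.1)) (by fun_prop)
  have h3 : Measurable fun q : Ω × ℝ × ℝ => |q.2.2 - q.2.1| :=
    (measurable_snd.snd.sub measurable_snd.fst).abs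
  exact (h3.ennreal_ofReal.pow_const _).mul (hγm.comp (h1.sub h2))

lemma measurable_hamiltonian (hXm : Measurable (Function.uncurry X)) (hγm : Measurable γ)
    (β₀ t : ℝ) : Measurable (hamiltonian β₀ γ X t) := by
  have h := measurable_hamiltonian_integrand hXm hγm β₀
  have h1 : Measurable fun q : Ω × ℝ => ∫⁻ r in Set.Icc (0 : ℝ) t,
      ENNReal.ofReal |r - q.2| ^ (-β₀) * γ (X r.toNNReal q.1 - X q.2.toNNReal q.1) :=
    Measurable.lintegral_prod_right' (f := fun q : (Ω × ℝ) × ℝ =>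
      ENNReal.ofReal |q.2 - q.1.2| ^ (-β₀) * γ (X q.2.toNNReal q.1.1 - X q.1.2.toNNReal q.1.1))
      (h.comp (f := fun q : (Ω × ℝ) × ℝ => (q.1.1, q.1.2, q.2)) (by fun_prop))
  exact h1.lintegral_prod_right'

lemma measurable_forwardFunctional (hXm : Measurable (Function.uncurry X)) (hγm : Measurable γ)
    (β₀ t : ℝ) : Measurable fun q : ℝ × Ω => forwardFunctional β₀ γ X t q.1 q.2 := by
  have h1 : Measurable fun q : (ℝ × Ω) × ℝ => X (q.1.1.toNNReal + q.2.toNNReal) q.1.2 :=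
    hXm.comp (f := fun q : (ℝ × Ω) × ℝ => (q.1.1.toNNReal + q.2.toNNReal, q.1.2)) (by fun_prop)
  have h2 : Measurable fun q : (ℝ × Ω) × ℝ => X q.1.1.toNNReal q.1.2 :=
    hXm.comp (f := fun q : (ℝ × Ω) × ℝ => (q.1.1.toNNReal, q.1.2)) (by fun_prop)
  exact Measurable.lintegral_prod_right' (f := fun q : (ℝ × Ω) × ℝ => timeWeight β₀ q.2 *
      γ (X (q.1.1.toNNReal + q.2.toNNReal) q.1.2 - X q.1.1.toNNReal q.1.2))
    (((measurable_timeWeight β₀).comp measurable_snd).mul (hγm.comp (h1.sub h2)))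

lemma hamiltonian_le_forwardFunctional (hXm : Measurable (Function.uncurry X))
    (hγ : IsAdmissibleKernel γ γhat) (β₀ t : ℝ) (ω : Ω) :
    hamiltonian β₀ γ X t ω ≤ 2 * ∫⁻ s in Set.Icc 0 t, forwardFunctional β₀ γ X t s ω := by
  set F : ℝ → ℝ → ℝ≥0∞ := fun s r =>
    ENNReal.ofReal |r - s| ^ (-β₀) * γ (X r.toNNReal ω - X s.toNNReal ω) with hF
  have h : Measurable (Function.uncurry F) :=
    (measurable_hamiltonian_integrand hXm hγ.continuous.measurable β₀).comp
      (measurable_prodMk_left (x := ω))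
  refine (lintegral_square_le_of_symm (F := F) h (fun s r => ?_) t).trans ?_
  · simp only [hF]
    rw [abs_sub_comm, ← hγ.even, neg_sub]
  · refine mul_le_mul' le_rfl (setLIntegral_mono' measurableSet_Icc fun s hs =>
      setLIntegral_mono' measurableSet_Ioc fun u hu => ?_)
    simp only [hF]
    rw [add_sub_cancel_left, abs_of_pos hu.1, Real.toNNReal_add hs.1 hu.1.le]
    rfl

lemma lintegral_hamiltonian_pow_le (hX : IsSymmetricLevyProcess X P)
    (hXm : Measurable (Function.uncurry X)) (hΨ : IsCharExponent X P Ψ)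
    (hγ : IsAdmissibleKernel γ γhat) (hβ₀ : 0 ≤ β₀) {θ t : ℝ} (hθ : 0 ≤ θ) (ht : 0 ≤ t)
    (hκ : discountedKernel β₀ Ψ γhat θ t < ∞) (n : ℕ) :
    ∫⁻ ω, hamiltonian β₀ γ X t ω ^ n ∂P ≤ n.factorial * (ENNReal.ofReal (Real.exp (θ * t)) *
      (2 * ENNReal.ofReal t * discountedKernel β₀ Ψ γhat θ t) ^ n) := by
  have hγm := hγ.continuous.measurable
  set κ := discountedKernel β₀ Ψ γhat θ t
  cases n with
  | zero =>
    simp only [pow_zero, lintegral_const, measure_univ, mul_one, Nat.factorial_zero, Nat.cast_one,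
      one_mul]
    exact ENNReal.one_le_ofReal.2 (Real.one_le_exp (mul_nonneg hθ ht))
  | succ n =>
    have hA := measurable_forwardFunctional hXm hγm β₀ t
    have hAs : ∀ ω, Measurable fun s => forwardFunctional β₀ γ X t s ω := fun ω =>
      hA.comp (measurable_prodMk_right (y := ω))
    have hApow : Measurable fun q : Ω × ℝ => forwardFunctional β₀ γ X t q.2 q.1 ^ (n + 1) :=
      (hA.comp measurable_swap).pow_const _
    calc ∫⁻ ω, hamiltonian β₀ γ X t ω ^ (n + 1) ∂P
        ≤ ∫⁻ ω, 2 ^ (n + 1) * (ENNReal.ofReal t ^ n *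
          ∫⁻ s in Set.Icc 0 t, forwardFunctional β₀ γ X t s ω ^ (n + 1)) ∂P := by
          refine lintegral_mono fun ω => ?_
          refine (pow_le_pow_left' (hamiltonian_le_forwardFunctional hXm hγ β₀ t ω) _).trans ?_
          rw [mul_pow]
          gcongr
          have := lintegral_pow_succ_le (volume.restrict (Set.Icc 0 t)) (hAs ω) n
          simpa using this
      _ = 2 ^ (n + 1) * (ENNReal.ofReal t ^ n * ∫⁻ s in Set.Icc 0 t,
          ∫⁻ ω, forwardFunctional β₀ γ X t s ω ^ (n + 1) ∂P) := by
          have hm : Measurable fun ω =>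
              ∫⁻ s in Set.Icc 0 t, forwardFunctional β₀ γ X t s ω ^ (n + 1) :=
            hApow.lintegral_prod_right'
          rw [lintegral_const_mul _ (hm.const_mul _), lintegral_const_mul _ hm,
            lintegral_lintegral_swap hApow.aemeasurable]
      _ ≤ 2 ^ (n + 1) * (ENNReal.ofReal t ^ n * ∫⁻ _ in Set.Icc 0 t, (n + 1).factorial *
          (ENNReal.ofReal (Real.exp (θ * t)) * κ ^ (n + 1))) := by
          gcongr with s
          exact lintegral_forwardFunctional_pow_le hX hXm hΨ hγ hβ₀ hθ ht hκ s (n + 1)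
      _ = _ := by
          rw [setLIntegral_const, Real.volume_Icc, sub_zero]
          ring

/-- Under Hypothesis (I) the discount rate can be taken so large that the moment bounds make the
exponential series converge geometrically. -/
lemma expMoment_lt_top (hX : IsSymmetricLevyProcess X P)
    (hXm : Measurable (Function.uncurry X)) (hΨ : IsCharExponent X P Ψ)
    (hγ : IsAdmissibleKernel γ γhat) (hβ₀ : β₀ ∈ Set.Ioo (0 : ℝ) 1)
    (hI : HypothesisI β₀ Ψ (spectralMeasure γhat)) {t lam : ℝ} (ht : 0 < t) (hlam : 0 < lam) :
    expMoment P β₀ γ X lam t < ∞ := by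
  have hγm := hγ.continuous.measurable
  have hΨm := measurable_charExponent hX hΨ
  have hkm : Measurable (spectralMean Ψ γhat) := measurable_spectralMean hΨm
  have hK := (lintegral_timeWeight_spectralMean_lt_top_iff hβ₀ hΨm (charExponent_nonneg hX hΨ)
    ht).2 hI
  -- With this bound on `κ` the ratio `lam * (2 t κ)` of the series is at most `1 / 2`.
  have hε : (0 : ℝ≥0∞) < ENNReal.ofReal (1 / (4 * lam * t)) := by
    rw [ENNReal.ofReal_pos]; positivity
  obtain ⟨θ, hθ, hκε⟩ := exists_discount_lt
    ((measurable_timeWeight β₀).mul hkm) hK hε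
  change discountedKernel β₀ Ψ γhat θ t < _ at hκε
  set κ := discountedKernel β₀ Ψ γhat θ t
  have hκ : κ < ∞ := hκε.trans ENNReal.ofReal_lt_top
  have hmom := lintegral_hamiltonian_pow_le hX hXm hΨ hγ hβ₀.1.le hθ ht.le hκ
  have hHm := measurable_hamiltonian hXm hγm β₀ t
  have hfin : ∀ᵐ ω ∂P, hamiltonian β₀ γ X t ω < ∞ := by
    have h1 := hmom 1
    simp only [pow_one] at h1
    refine ae_lt_top hHm (h1.trans_lt ?_).ne
    exact ENNReal.mul_lt_top (by simp) (ENNReal.mul_lt_top (by simp)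
      (ENNReal.mul_lt_top (ENNReal.mul_lt_top (by simp) (by simp)) hκ))
  have hratio : ENNReal.ofReal lam * (2 * ENNReal.ofReal t * κ) ≤ ENNReal.ofReal (1 / 2) := by
    calc ENNReal.ofReal lam * (2 * ENNReal.ofReal t * κ)
        ≤ ENNReal.ofReal lam * (ENNReal.ofReal 2 * ENNReal.ofReal t *
          ENNReal.ofReal (1 / (4 * lam * t))) := by
          gcongr
          simp
      _ = _ := by
          rw [← ENNReal.ofReal_mul (by norm_num), ← ENNReal.ofReal_mul (by positivity),
            ← ENNReal.ofReal_mul (by positivity)]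
          congr 1
          field_simp
          norm_num
  calc expMoment P β₀ γ X lam t
      = ∫⁻ ω, ∑' n : ℕ, (ENNReal.ofReal lam * hamiltonian β₀ γ X t ω) ^ n / n.factorial ∂P := by
        refine lintegral_congr_ae ?_
        filter_upwards [hfin] with ω hω
        exact EReal_exp_coe_eq_tsum (ENNReal.mul_lt_top (by simp) hω).ne
    _ = ∑' n : ℕ, ∫⁻ ω, (ENNReal.ofReal lam * hamiltonian β₀ γ X t ω) ^ n / n.factorial ∂P :=
        lintegral_tsum fun n => (((hHm.const_mul _).pow_const n).div_const _).aemeasurable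
    _ ≤ ∑' n : ℕ, ENNReal.ofReal (Real.exp (θ * t)) * ENNReal.ofReal (1 / 2) ^ n := by
        refine ENNReal.tsum_le_tsum fun n => ?_
        have hfac : (n.factorial : ℝ≥0∞) ≠ 0 := by exact_mod_cast n.factorial_ne_zero
        calc ∫⁻ ω, (ENNReal.ofReal lam * hamiltonian β₀ γ X t ω) ^ n / n.factorial ∂P
            = ENNReal.ofReal lam ^ n * (∫⁻ ω, hamiltonian β₀ γ X t ω ^ n ∂P)
              * (n.factorial : ℝ≥0∞)⁻¹ := by
              simp_rw [div_eq_mul_inv, mul_pow]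
              rw [lintegral_mul_const _ ((hHm.pow_const n).const_mul _),
                lintegral_const_mul _ (hHm.pow_const n)]
          _ ≤ ENNReal.ofReal lam ^ n * (n.factorial * (ENNReal.ofReal (Real.exp (θ * t)) *
              (2 * ENNReal.ofReal t * κ) ^ n)) * (n.factorial : ℝ≥0∞)⁻¹ := by
              gcongr
              exact hmom n
          _ = ((n.factorial : ℝ≥0∞) * (n.factorial : ℝ≥0∞)⁻¹) * (ENNReal.ofReal (Real.exp (θ * t)) *
              (ENNReal.ofReal lam * (2 * ENNReal.ofReal t * κ)) ^ n) := by ring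
          _ ≤ _ := by
              rw [ENNReal.mul_inv_cancel hfac (by simp), one_mul]
              gcongr
    _ < ∞ := by
        rw [ENNReal.tsum_mul_left, ENNReal.tsum_geometric]
        refine ENNReal.mul_lt_top (by simp) (ENNReal.inv_lt_top.2 (tsub_pos_of_lt ?_))
        rw [ENNReal.ofReal_lt_one]
        norm_num

lemma meanHamiltonian_eq (hX : IsSymmetricLevyProcess X P)
    (hXm : Measurable (Function.uncurry X)) (hγm : Measurable γ) (t : ℝ) :
    meanHamiltonian P β₀ γ X t = ∫⁻ s in Set.Icc (0 : ℝ) t, ∫⁻ r in Set.Icc (0 : ℝ) t,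
      ENNReal.ofReal |r - s| ^ (-β₀) * ∫⁻ ω, γ (X r.toNNReal ω - X s.toNNReal ω) ∂P := by
  have h := measurable_hamiltonian_integrand hXm hγm β₀
  have h1 : Measurable fun q : Ω × ℝ => ∫⁻ r in Set.Icc (0 : ℝ) t,
      ENNReal.ofReal |r - q.2| ^ (-β₀) * γ (X r.toNNReal q.1 - X q.2.toNNReal q.1) :=
    Measurable.lintegral_prod_right' (f := fun q : (Ω × ℝ) × ℝ =>
      ENNReal.ofReal |q.2 - q.1.2| ^ (-β₀) * γ (X q.2.toNNReal q.1.1 - X q.1.2.toNNReal q.1.1))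
      (h.comp (f := fun q : (Ω × ℝ) × ℝ => (q.1.1, q.1.2, q.2)) (by fun_prop))
  rw [meanHamiltonian]
  simp only [hamiltonian]
  rw [lintegral_lintegral_swap h1.aemeasurable]
  refine lintegral_congr fun s => ?_
  have h2 : Measurable fun q : Ω × ℝ =>
      ENNReal.ofReal |q.2 - s| ^ (-β₀) * γ (X q.2.toNNReal q.1 - X s.toNNReal q.1) :=
    h.comp (f := fun q : Ω × ℝ => (q.1, s, q.2)) (by fun_prop)
  rw [lintegral_lintegral_swap h2.aemeasurable]
  refine lintegral_congr fun r => ?_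
  rw [lintegral_const_mul]
  exact hγm.comp ((hX.measurable _).sub (hX.measurable _))

/-- Restricting to `s ≤ t / 2` and `s < r ≤ s + t / 2` bounds the mean below by a time integral of
the spectral means. -/
lemma le_meanHamiltonian (hX : IsSymmetricLevyProcess X P) (hq : HasTransitionDensities X P)
    (hXm : Measurable (Function.uncurry X)) (hΨ : IsCharExponent X P Ψ)
    (hγ : IsAdmissibleKernel γ γhat) (t : ℝ) :
    ENNReal.ofReal (t / 2) * ∫⁻ u in Set.Ioc 0 (t / 2), timeWeight β₀ u * spectralMean Ψ γhat u
      ≤ meanHamiltonian P β₀ γ X t := by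
  have hγm := hγ.continuous.measurable
  set K := ∫⁻ u in Set.Ioc 0 (t / 2), timeWeight β₀ u * spectralMean Ψ γhat u with hK
  rw [meanHamiltonian_eq hX hXm hγm]
  calc ENNReal.ofReal (t / 2) * K = ∫⁻ _ in Set.Icc 0 (t / 2), K := by
        rw [setLIntegral_const, Real.volume_Icc, sub_zero, mul_comm]
    _ ≤ ∫⁻ s in Set.Icc 0 (t / 2), ∫⁻ r in Set.Icc (0 : ℝ) t,
      ENNReal.ofReal |r - s| ^ (-β₀) * ∫⁻ ω, γ (X r.toNNReal ω - X s.toNNReal ω) ∂P := by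
        refine setLIntegral_mono' measurableSet_Icc fun s hs => ?_
        calc K = ∫⁻ r, (Set.Ioc 0 (t / 2)).indicator
              (fun u => timeWeight β₀ u * spectralMean Ψ γhat u) (r - s) := by
              rw [lintegral_sub_right_eq_self, lintegral_indicator measurableSet_Ioc]
          _ ≤ ∫⁻ r, (Set.Icc (0 : ℝ) t).indicator (fun r => ENNReal.ofReal |r - s| ^ (-β₀) *
              ∫⁻ ω, γ (X r.toNNReal ω - X s.toNNReal ω) ∂P) r := by
              refine lintegral_mono fun r => ?_
              by_cases hr : r - s ∈ Set.Ioc 0 (t / 2)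
              · have hrI : r ∈ Set.Icc 0 t := ⟨by linarith [hs.1, hr.1], by linarith [hs.2, hr.2]⟩
                have hr0 : 0 ≤ r - s := hr.1.le
                have hrs : r.toNNReal = s.toNNReal + (r - s).toNNReal := by
                  rw [← Real.toNNReal_add hs.1 hr0]
                  congr 1
                  ring
                have hlaw : ∫⁻ ω, γ (X r.toNNReal ω - X s.toNNReal ω) ∂P
                    = spectralMean Ψ γhat (r - s) := by
                  have h1 := lintegral_kernel_levy hX hq hΨ hγ (r - s).toNNReal
                    (Real.toNNReal_pos.2 hr.1)
                  rw [Real.coe_toNNReal _ hr0] at h1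
                  have hm : Measurable fun ω =>
                      X (s.toNNReal + (r - s).toNNReal) ω - X s.toNNReal ω :=
                    (hX.measurable _).sub (hX.measurable _)
                  rw [← h1, ← hX.stationary_increments s.toNNReal, lintegral_map hγm hm, hrs]
                rw [Set.indicator_of_mem hr, Set.indicator_of_mem hrI, hlaw, abs_of_pos hr.1]
                rfl
              · rw [Set.indicator_of_notMem hr]
                exact zero_le
          _ = _ := lintegral_indicator measurableSet_Icc _
    _ ≤ _ := by
        by_cases ht : 0 ≤ t
        · exact lintegral_mono_set (Set.Icc_subset_Icc_right (by linarith))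
        · rw [Set.Icc_eq_empty (by linarith)]
          simp

end Hamiltonian

end LevyHamiltonian

theorem theorem3p4 {Ω : Type*} [MeasurableSpace Ω] (P : Measure Ω) [IsProbabilityMeasure P]
    {d : ℕ} (hd : 0 < d)
    (X : ℝ≥0 → Ω → Space d) (hX : IsSymmetricLevyProcess X P) (hq : HasTransitionDensities X P)
    (Ψ : Space d → ℝ) (hΨ : IsCharExponent X P Ψ)
    (β₀ : ℝ) (hβ₀ : β₀ ∈ Set.Ioo (0 : ℝ) 1)
    (γ : Space d → ℝ≥0∞) (γhat : Space d → ℝ) (hγ : IsAdmissibleKernel γ γhat) :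
    (HypothesisI β₀ Ψ (spectralMeasure γhat) →
      ∀ t lam : ℝ, 0 < t → 0 < lam → expMoment P β₀ γ X lam t < ∞) ∧
    (HypothesisI β₀ Ψ (spectralMeasure γhat) ↔
      ∀ t : ℝ, 0 < t → meanHamiltonian P β₀ γ X t < ∞) ∧
    (∀ t : ℝ, 0 < t →
      (meanHamiltonian P β₀ γ X t < ∞ ↔ ∀ lam : ℝ, 0 < lam → expMoment P β₀ γ X lam t < ∞)) := by
  obtain ⟨Y, hYX, hYm⟩ := exists_measurable_modification hX
  have hY := hX.congr (fun t => hYm.comp (measurable_prodMk_left (x := t))) hYX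
  have hlaw : ∀ t, P.map (Y t) = P.map (X t) := fun t =>
    Measure.map_congr (hYX.mono fun ω h => h t)
  have hqY : HasTransitionDensities Y P := fun t ht => by rw [hlaw]; exact hq t ht
  have hΨY : IsCharExponent Y P Ψ := fun t ξ => by rw [hlaw]; exact hΨ t ξ
  have hH : ∀ t, ∀ᵐ ω ∂P, hamiltonian β₀ γ X t ω = hamiltonian β₀ γ Y t ω := fun t => by
    filter_upwards [hYX] with ω h
    simp only [hamiltonian, h]
  have hmean : ∀ t, meanHamiltonian P β₀ γ X t = meanHamiltonian P β₀ γ Y t := fun t =>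
    lintegral_congr_ae (hH t)
  have hexp : ∀ lam t, expMoment P β₀ γ X lam t = expMoment P β₀ γ Y lam t := fun lam t => by
    refine lintegral_congr_ae ?_
    filter_upwards [hH t] with ω h
    rw [h]
  have ha : HypothesisI β₀ Ψ (spectralMeasure γhat) →
      ∀ t lam : ℝ, 0 < t → 0 < lam → expMoment P β₀ γ X lam t < ∞ := fun hI t lam ht hlam => by
    rw [hexp]
    exact expMoment_lt_top hY hYm hΨY hγ hβ₀ hI ht hlam
  have hmean_exp : ∀ t, expMoment P β₀ γ X 1 t < ∞ → meanHamiltonian P β₀ γ X t < ∞ :=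
    fun t h => by
      refine (lintegral_mono fun ω => ?_).trans_lt h
      simpa using le_EReal_exp_coe (hamiltonian β₀ γ X t ω)
  have hmean_I : ∀ t, 0 < t → meanHamiltonian P β₀ γ X t < ∞ →
      HypothesisI β₀ Ψ (spectralMeasure γhat) := fun t ht h => by
    rw [hmean] at h
    refine (lintegral_timeWeight_spectralMean_lt_top_iff hβ₀ (measurable_charExponent hX hΨ)
      (charExponent_nonneg hX hΨ) (half_pos ht)).1 ?_
    refine ENNReal.lt_top_of_mul_ne_top_right
      ((le_meanHamiltonian hY hqY hYm hΨY hγ t).trans_lt h).ne ?_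
    simpa using ht
  exact ⟨ha, ⟨fun hI t ht => hmean_exp t (ha hI t 1 ht one_pos),
    fun h => hmean_I 1 one_pos (h 1 one_pos)⟩, fun t ht =>
    ⟨fun h lam hlam => ha (hmean_I t ht h) t lam ht hlam, fun h => hmean_exp t (h 1 one_pos)⟩⟩
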